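/- Let $P\ge 0$, $Q>0$, $N\ge 0$ and $\sigma_u\in\mathbb R$, with $N>0$ or $\sigma_u\neq 0$. Consider the channel $Y_i=X_i+S_i+Z_i$, where $S_i\sim\mathrm N(0,Q)$ and $Z_i\sim \mathrm N(0,N)$ are i.i.d. sequences, and where the sender observes noncausally $V_i=S_i+U_i$ with $U_i\sim\mathrm N(0,\sigma_u^2)$ i.i.d.; the message $M$ and the sequences $\{S_i\}$, $\{U_i\}$, $\{Z_i\}$ are independent. A $(2^{nR},n)$ code consists of an encoder $(m,v^n)\mapsto x^n\in\mathbb R^n$ for $m\in\{1,\dots,2^{\lceil nR\rceil}\}$ and $v^n\in\mathbb R^n$ (a single message if $R<0$), and a decoder $y^n\mapsto(\hat m,\hat s^n)$ with $\hat s^n\in\mathbb R^n$, both measurable. The message $M$ is uniformly distributed, and the code satisfies $\frac1n\sum_{i=1}^n\mathbb E[X_i^2]\le P$. A pair $(R,D)$ of real numbers is achievable if there is a sequence of $(2^{nR},n)$ codes with $\lim_{n\to\infty}\mathbb P\{\hat M\ne M\}=0$ and $\limsup_{n\to\infty}\frac1n\sum_{i=1}^n\mathbb E[(S_i-\hat S_i)^2]\le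 D$. Put $\lambda=\frac{Q}{Q+\sigma_u^2}$, $Q'=\frac{Q^2}{Q+\sigma_u^2}$, $N'=\frac{Q\sigma_u^2}{Q+\sigma_u^2}$ and, for $0\le x\le Q'$, $$f(x)=\Bigl(\sqrt{x}-\sqrt{N'/Q'}\,\sqrt{Q'-x}\Bigr)_+^2,$$ where $x_+=\max\{x,0\}$. Then $f$ is convex and nondecreasing on $[0,Q']$. Moreover, if $(R,D)$ is achievable, then there is an $\bar r\in\bigl[0,\sqrt{P(Q+\sigma_u^2)}\bigr]$ such that both $$R\le\frac12\log_2\frac{\sigma_u^2(N+P+Q)+Q(N+P)-\bar r^2}{(Q+\sigma_u^2)(N+N')}$$ and $$D\ge f\!\left(\frac{Q'(N+N')}{P+Q+N+2\lambda\bar r}\;2^{2R}\right).$$ -/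

import Mathlib

open MeasureTheory ProbabilityTheory Filter Topology
open scoped ENNReal

namespace StateAmp

noncomputable section

/-- A code with `K` messages and block length `n`: an encoder mapping a message and the
noisy state observation `v^n` to a transmit sequence `x^n`, and a decoder mapping the received
sequence `y^n` to a message estimate and a state estimate. -/
structure Code (K n : ℕ) where
  /-- the encoder -/
  enc : Fin K → (Fin n → ℝ) → (Fin n → ℝ)
  /-- the decoder: message estimate and state estimate -/
  dec : (Fin n → ℝ) → Fin K × (Fin n → ℝ)
  measurable_enc : ∀ m, Measurable (enc m)
  measurable_dec : Measurable dec

/-- A realization of the basic random variables: the message `M`, the state `S^n`, the state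
observation noise `U^n` and the channel noise `Z^n`. -/
structure Outcome (K n : ℕ) where
  /-- message -/
  M : Fin K
  /-- state sequence -/
  S : Fin n → ℝ
  /-- state observation noise -/
  U : Fin n → ℝ
  /-- channel noise -/
  Z : Fin n → ℝ

/-- The product space carrying `(M, S^n, U^n, Z^n)`. -/
abbrev Sample (K n : ℕ) : Type :=
  Fin K × (Fin n → ℝ) × (Fin n → ℝ) × (Fin n → ℝ)

/-- The components of a sample point, by name. -/
def Sample.outcome {K n : ℕ} (ω : Sample K n) : Outcome K n :=
  ⟨ω.1, ω.2.1, ω.2.2.1, ω.2.2.2⟩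

/-- The law of an i.i.d. `N(0, v)` sequence of length `n`. -/
def iidGaussian (n : ℕ) (v : ℝ) : Measure (Fin n → ℝ) :=
  Measure.pi fun _ => gaussianReal 0 v.toNNReal

/-- The joint law of `(M, S^n, U^n, Z^n)`: `M` is uniform, `S_i ∼ N(0, Q)`, `U_i ∼ N(0, σu²)`,
`Z_i ∼ N(0, N)`, all independent. -/
def law (K n : ℕ) (Q σu N : ℝ) : Measure (Sample K n) :=
  (uniformOn (Set.univ : Set (Fin K))).prod
    ((iidGaussian n Q).prod ((iidGaussian n (σu ^ 2)).prod (iidGaussian n N)))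

namespace Code

variable {K n : ℕ} (c : Code K n)

/-- The noisy state observation `V_i = S_i + U_i`. -/
def V (ω : Sample K n) : Fin n → ℝ := fun i => ω.outcome.S i + ω.outcome.U i

/-- The channel input `X^n = enc (M, V^n)`. -/
def X (ω : Sample K n) : Fin n → ℝ := c.enc ω.outcome.M (V ω)

/-- The channel output `Y_i = X_i + S_i + Z_i`. -/
def Y (ω : Sample K n) : Fin n → ℝ :=
  fun i => c.X ω i + ω.outcome.S i + ω.outcome.Z i

/-- The message estimate. -/
def Mhat (ω : Sample K n) : Fin K := (c.dec (c.Y ω)).1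

/-- The state estimate. -/
def Shat (ω : Sample K n) : Fin n → ℝ := (c.dec (c.Y ω)).2

/-- The average transmit power `(1/n) ∑ E[X_i²]`, in `[0, ∞]`. -/
def power (Q σu N : ℝ) : ℝ≥0∞ :=
  (n : ℝ≥0∞)⁻¹ * ∑ i, ∫⁻ ω, ENNReal.ofReal (c.X ω i ^ 2) ∂(law K n Q σu N)

/-- The probability of error `P{M̂ ≠ M}`. -/
def errorProb (Q σu N : ℝ) : ℝ≥0∞ :=
  law K n Q σu N {ω | c.Mhat ω ≠ ω.outcome.M}

/-- The state distortion `(1/n) ∑ E[(S_i - Ŝ_i)²]`, in `[0, ∞]`. -/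
def distortion (Q σu N : ℝ) : ℝ≥0∞ :=
  (n : ℝ≥0∞)⁻¹ *
    ∑ i, ∫⁻ ω, ENNReal.ofReal ((ω.outcome.S i - c.Shat ω i) ^ 2) ∂(law K n Q σu N)

end Code

/-- `(R, D)` is achievable: there are `(2^{nR}, n)` codes, with message set
`{1, …, 2^⌈nR⌉}`, that satisfy the power constraint, have vanishing probability of error, and
whose asymptotic distortion is at most `D`. The `limsup` is taken in the extended reals, so that it
is meaningful for unbounded sequences and the comparison with `D` is correct for every real `D`. -/
def Achievable (P Q N σu R D : ℝ) : Prop :=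
  ∃ c : ∀ n : ℕ, Code (2 ^ ⌈(n : ℝ) * R⌉₊) n,
    (∀ n, (c n).power Q σu N ≤ ENNReal.ofReal P) ∧
    Tendsto (fun n => (c n).errorProb Q σu N) atTop (𝓝 0) ∧
    limsup (fun n => (((c n).distortion Q σu N : ℝ≥0∞) : EReal)) atTop ≤ (D : EReal)

/-- The variance `Q' = Q² / (Q + σu²)` of the observable part of the state. -/
def Qp (Q σu : ℝ) : ℝ := Q ^ 2 / (Q + σu ^ 2)

/-- The variance `N' = Q σu² / (Q + σu²)` of the unobservable part of the state. -/
def Np (Q σu : ℝ) : ℝ := Q * σu ^ 2 / (Q + σu ^ 2)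

/-- The coefficient `λ = Q / (Q + σu²)`. -/
def lam (Q σu : ℝ) : ℝ := Q / (Q + σu ^ 2)

/-- `f(x) = ((√x - √(N'/Q') √(Q' - x))₊)²`, meant for `0 ≤ x ≤ Q'`. -/
def f (Q σu x : ℝ) : ℝ :=
  (max (√x - √(Np Q σu / Qp Q σu) * √(Qp Q σu - x)) 0) ^ 2

end

end StateAmp

namespace StateAmp

noncomputable section

/-! Split `S = λV + T`, where `T` has variance `N'` and is independent of `V`. The channel becomes
`Y = X + λV + W` with `W = T + Z` of variance `ν = N + N' > 0`, independent of `(M, V)`.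

The converse uses a change of measure in place of entropies. If a positive test function has mean at
most 1 under a reference law where `Y = aV + N(0, τ)`, then its expected logarithm under the true
law is at most a relative entropy (`integral_log_le_of_lintegral_le_one`). When `τ` dominates the
power of `Y - aV`, this is at most `(n/2) log(τ/ν)`. The test function is a reward for decoding `M`,
in the role of Fano's inequality, times a factor `g(V, Y)` (`Code.log_card_add_integral_log_le`).

Let `r` be the average correlation of `X` and `V`. Taking `g = 1` and `a` the regression coefficient
of `Y` on `V` gives the rate bound. Taking `a = 0` and `g` a ratio of Gaussian densities gives a
joint bound on the rate and on the error of any estimate of `V` from `Y`. Since `T` is orthogonal to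
`λV`, an estimate of `S` with small error has a multiple that estimates `λV` well
(`exists_smul_approx`); this trade-off is exactly `f`. Working in the Hilbert space of random
`n`-vectors makes a single-letter convexity step unnecessary: the converse needs only monotonicity
and continuity of `f`. A convergent subsequence of `|r|` yields one value serving both bounds.

Convexity of `f` comes separately, from affine minorants that touch it. -/

instance isProbabilityMeasure_iidGaussian (n : ℕ) (v : ℝ) :
    IsProbabilityMeasure (iidGaussian n v) := by
  unfold iidGaussian; infer_instance

/-! ### Linear images of i.i.d. Gaussian sequences -/

lemma charFunDual_gaussianReal_zero (v : ℝ) (hv : 0 ≤ v) (L : StrongDual ℝ ℝ) :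
    charFunDual (gaussianReal 0 v.toNNReal) L = Complex.exp (-(v * (L 1) ^ 2 / 2 : ℝ)) := by
  rw [charFunDual_eq_charFun_map_one]
  have h : (L : ℝ → ℝ) = fun x => L 1 * x := by
    ext x
    rw [← smul_eq_mul, smul_eq_mul, mul_comm, ← smul_eq_mul, ← map_smul, smul_eq_mul, mul_one]
  rw [h, gaussianReal_map_const_mul, charFun_gaussianReal]
  congr 1
  simp [hv]
  ring

/-- The best linear estimate of a Gaussian variable from a noisy Gaussian observation has an
error that is independent of the observation. -/
lemma measurePreserving_observation (a b : ℝ) (ha : 0 < a) (hb : 0 ≤ b) :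
    MeasurePreserving (fun p : ℝ × ℝ => (p.1 + p.2, p.1 - a / (a + b) * (p.1 + p.2)))
      ((gaussianReal 0 a.toNNReal).prod (gaussianReal 0 b.toNNReal))
      ((gaussianReal 0 (a + b).toNNReal).prod (gaussianReal 0 (a * b / (a + b)).toNNReal)) := by
  refine ⟨by fun_prop, ?_⟩
  let A : ℝ × ℝ →L[ℝ] ℝ := ContinuousLinearMap.fst ℝ ℝ ℝ + ContinuousLinearMap.snd ℝ ℝ ℝ
  let T : ℝ × ℝ →L[ℝ] ℝ × ℝ :=
    A.prod (ContinuousLinearMap.fst ℝ ℝ ℝ - (a / (a + b)) • A)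
  have hT : (fun p : ℝ × ℝ => (p.1 + p.2, p.1 - a / (a + b) * (p.1 + p.2))) = T := by
    ext p <;> simp [T, A, mul_add]
  rw [hT]
  -- Both laws are centred Gaussian, so comparing characteristic functions leaves an identity of
  -- quadratic forms in `L (1, 0)` and `L (0, 1)`.
  refine Measure.ext_of_charFunDual (funext fun L => ?_)
  have hL : ∀ x y : ℝ, L (x, y) = x * L (1, 0) + y * L (0, 1) := by
    intro x y
    rw [← smul_eq_mul, ← smul_eq_mul, ← map_smul, ← map_smul, ← map_add]
    simp
  rw [charFunDual_map, charFunDual_prod, charFunDual_prod,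
    charFunDual_gaussianReal_zero _ ha.le, charFunDual_gaussianReal_zero _ hb,
    charFunDual_gaussianReal_zero _ (by positivity),
    charFunDual_gaussianReal_zero _ (by positivity), ← Complex.exp_add, ← Complex.exp_add]
  congr 1
  simp only [ContinuousLinearMap.comp_apply, ContinuousLinearMap.inl_apply,
    ContinuousLinearMap.inr_apply, ← hT]
  rw [← Complex.ofReal_neg, ← Complex.ofReal_neg, ← Complex.ofReal_neg, ← Complex.ofReal_neg,
    ← Complex.ofReal_add, ← Complex.ofReal_add]
  congr 1
  rw [hL (1 + 0), hL (0 + 1)]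
  have : a + b ≠ 0 := by positivity
  field_simp
  ring

lemma measurePreserving_gaussianReal_add (a b : ℝ) (ha : 0 ≤ a) (hb : 0 ≤ b) :
    MeasurePreserving (fun p : ℝ × ℝ => p.1 + p.2)
      ((gaussianReal 0 a.toNNReal).prod (gaussianReal 0 b.toNNReal))
      (gaussianReal 0 (a + b).toNNReal) := by
  refine ⟨by fun_prop, ?_⟩
  rw [Real.toNNReal_add ha hb]
  have := gaussianReal_conv_gaussianReal (m₁ := 0) (m₂ := 0) (v₁ := a.toNNReal)
    (v₂ := b.toNNReal)
  rw [Measure.conv, add_zero] at this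
  exact this

lemma measurePreserving_iidGaussian_observation (n : ℕ) (a b : ℝ) (ha : 0 < a) (hb : 0 ≤ b) :
    MeasurePreserving
      (fun p : (Fin n → ℝ) × (Fin n → ℝ) =>
        ((fun i => p.1 i + p.2 i : Fin n → ℝ),
          (fun i => p.1 i - a / (a + b) * (p.1 i + p.2 i) : Fin n → ℝ)))
      ((iidGaussian n a).prod (iidGaussian n b))
      ((iidGaussian n (a + b)).prod (iidGaussian n (a * b / (a + b)))) := by
  have h1 := (measurePreserving_arrowProdEquivProdArrow ℝ ℝ (Fin n)
    (fun _ => gaussianReal 0 a.toNNReal) (fun _ => gaussianReal 0 b.toNNReal)).symm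
  have h2 := measurePreserving_arrowProdEquivProdArrow ℝ ℝ (Fin n)
    (fun _ => gaussianReal 0 (a + b).toNNReal)
    (fun _ => gaussianReal 0 (a * b / (a + b)).toNNReal)
  exact h2.comp ((measurePreserving_pi _ _
    (fun _ : Fin n => measurePreserving_observation a b ha hb)).comp h1)

lemma measurePreserving_iidGaussian_add (n : ℕ) (a b : ℝ) (ha : 0 ≤ a) (hb : 0 ≤ b) :
    MeasurePreserving
      (fun p : (Fin n → ℝ) × (Fin n → ℝ) => (fun i => p.1 i + p.2 i : Fin n → ℝ))
      ((iidGaussian n a).prod (iidGaussian n b)) (iidGaussian n (a + b)) := by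
  have h1 := (measurePreserving_arrowProdEquivProdArrow ℝ ℝ (Fin n)
    (fun _ => gaussianReal 0 a.toNNReal) (fun _ => gaussianReal 0 b.toNNReal)).symm
  exact (measurePreserving_pi _ _
    (fun _ : Fin n => measurePreserving_gaussianReal_add a b ha hb)).comp h1

/-! ### Moments -/

section Moments

variable {Ω Θ : Type*} [MeasurableSpace Ω] [MeasurableSpace Θ] {P : Measure Ω} {n : ℕ} {v : ℝ}

lemma measurePreserving_eval_iidGaussian (i : Fin n) :
    MeasurePreserving (fun w : Fin n → ℝ => w i) (iidGaussian n v)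
      (gaussianReal 0 v.toNNReal) :=
  measurePreserving_eval (fun _ : Fin n => gaussianReal 0 v.toNNReal) i

lemma memLp_of_iidGaussian {W : Ω → Fin n → ℝ}
    (hW : MeasurePreserving W P (iidGaussian n v)) (i : Fin n) :
    MemLp (fun ω => W ω i) 2 P := by
  have h := (measurePreserving_eval_iidGaussian (v := v) i).comp hW
  exact (memLp_id_gaussianReal (μ := 0) (v := v.toNNReal) 2).comp_measurePreserving h

lemma integral_sq_of_iidGaussian {W : Ω → Fin n → ℝ} (hv : 0 ≤ v)
    (hW : MeasurePreserving W P (iidGaussian n v)) (i : Fin n) :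
    ∫ ω, W ω i ^ 2 ∂P = v := by
  have h := (measurePreserving_eval_iidGaussian (v := v) i).comp hW
  have h2 := integral_map (μ := P) h.aemeasurable (f := fun x : ℝ => x ^ 2)
    (by fun_prop)
  rw [h.map_eq] at h2
  have h3 := variance_id_gaussianReal (μ := 0) (v := v.toNNReal)
  rw [variance_eq_integral (by fun_prop)] at h3
  simp only [id, integral_id_gaussianReal, sub_zero, Real.coe_toNNReal _ hv] at h3
  exact h2.symm.trans h3

/-- Independence factors the expectation, and the Gaussian factor has mean zero. The product formula
for integrals needs no integrability, so `F` is only asked to be measurable. -/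
lemma integral_mul_of_iidGaussian {θ : Ω → Θ} {W : Ω → Fin n → ℝ} {μ : Measure Θ} [SFinite μ]
    (h : MeasurePreserving (fun ω => (θ ω, W ω)) P (μ.prod (iidGaussian n v)))
    {F : Θ → ℝ} (hF : Measurable F) (i : Fin n) :
    ∫ ω, F (θ ω) * W ω i ∂P = 0 := by
  have h2 := integral_map (μ := P) h.aemeasurable
    (f := fun p : Θ × (Fin n → ℝ) => F p.1 * p.2 i)
    (by
      have : Measurable (fun p : Θ × (Fin n → ℝ) => F p.1 * p.2 i) := by fun_prop
      exact this.aestronglyMeasurable)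
  rw [h.map_eq] at h2
  rw [← h2, integral_prod_mul (fun x => F x) (fun w : Fin n → ℝ => w i)]
  have h3 := measurePreserving_eval_iidGaussian (v := v) i
  have h4 := integral_map (μ := iidGaussian n v) h3.aemeasurable (f := fun x : ℝ => x)
    (by fun_prop)
  rw [h3.map_eq, integral_id_gaussianReal] at h4
  rw [← h4, mul_zero]

end Moments

/-! ### Densities -/

/-- The density of an i.i.d. `N(0, v)` sequence. -/
def iidDensity {n : ℕ} (v : ℝ) (w : Fin n → ℝ) : ℝ :=
  ∏ i, gaussianPDFReal 0 v.toNNReal (w i)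

section Density

variable {n : ℕ} {v : ℝ}

@[fun_prop]
lemma measurable_iidDensity : Measurable (iidDensity (n := n) v) := by
  unfold iidDensity; fun_prop

lemma iidDensity_pos (hv : 0 < v) (w : Fin n → ℝ) : 0 < iidDensity v w :=
  Finset.prod_pos fun i _ => gaussianPDFReal_pos _ _ _ (by simpa using hv)

lemma log_iidDensity (hv : 0 < v) (w : Fin n → ℝ) :
    Real.log (iidDensity v w)
      = -(n / 2 * Real.log (2 * Real.pi * v)) - (∑ i, w i ^ 2) / (2 * v) := by
  have hv' : v.toNNReal ≠ 0 := by simpa using hv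
  rw [iidDensity, Real.log_prod (fun i _ => (gaussianPDFReal_pos _ _ _ hv').ne')]
  have : ∀ i, Real.log (gaussianPDFReal 0 v.toNNReal (w i))
      = -(1 / 2 * Real.log (2 * Real.pi * v)) - w i ^ 2 / (2 * v) := by
    intro i
    rw [gaussianPDFReal, Real.coe_toNNReal _ hv.le, Real.log_mul (by positivity) (by positivity),
      Real.log_inv, Real.log_sqrt (by positivity), Real.log_exp]
    ring
  simp_rw [this]
  rw [Finset.sum_sub_distrib, Finset.sum_div]
  simp
  ring

lemma iidGaussian_eq_withDensity (hv : 0 < v) :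
    iidGaussian n v = volume.withDensity (fun w => ENNReal.ofReal (iidDensity v w)) := by
  have hv' : v.toNNReal ≠ 0 := by simpa using hv
  refine Measure.pi_eq fun s hs => ?_
  rw [withDensity_apply _ (MeasurableSet.univ_pi hs), volume_pi, Measure.restrict_pi_pi]
  unfold iidDensity
  rw [← ofReal_integral_eq_lintegral_ofReal, integral_fintype_prod_eq_prod,
    ENNReal.ofReal_prod_of_nonneg]
  · simp_rw [gaussianReal_apply_eq_integral _ hv']
  · exact fun i _ => integral_nonneg fun x => gaussianPDFReal_nonneg _ _ _
  · exact Integrable.fintype_prod (f := fun _ x => gaussianPDFReal 0 v.toNNReal x)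
      fun i => (integrable_gaussianPDFReal _ _).restrict
  · exact ae_of_all _ fun w => Finset.prod_nonneg fun i _ => gaussianPDFReal_nonneg _ _ _

lemma lintegral_iidGaussian (hv : 0 < v) (F : (Fin n → ℝ) → ℝ≥0∞) :
    ∫⁻ w, F w ∂(iidGaussian n v) = ∫⁻ w, ENNReal.ofReal (iidDensity v w) * F w := by
  rw [iidGaussian_eq_withDensity hv,
    lintegral_withDensity_eq_lintegral_mul_non_measurable _ (by fun_prop)
      (ae_of_all _ fun _ => ENNReal.ofReal_lt_top)]
  rfl

end Density

/-! ### The law of the message, the observation and the effective noise -/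

section Law

variable {K n : ℕ} {Q σu N : ℝ}

lemma measurePreserving_observation_law [NeZero K] (hQ : 0 < Q) :
    MeasurePreserving
      (fun ω : Sample K n => (Code.V ω, fun i => ω.outcome.S i - lam Q σu * Code.V ω i))
      (law K n Q σu N)
      ((iidGaussian n (Q + σu ^ 2)).prod (iidGaussian n (Np Q σu))) := by
  have h1 := measurePreserving_iidGaussian_observation n Q (σu ^ 2) hQ (sq_nonneg _)
  have h2 : MeasurePreserving Prod.fst
      (((iidGaussian n Q).prod (iidGaussian n (σu ^ 2))).prod (iidGaussian n N))
      ((iidGaussian n Q).prod (iidGaussian n (σu ^ 2))) := measurePreserving_fst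
  have h3 := (measurePreserving_prodAssoc (iidGaussian n Q) (iidGaussian n (σu ^ 2))
    (iidGaussian n N)).symm
  have h4 : MeasurePreserving Prod.snd (law K n Q σu N) _ := measurePreserving_snd
  exact h1.comp (h2.comp (h3.comp h4))

/-- The estimation error `S - λV` is independent of `V`, and adding the independent `Z` keeps the
sum independent of `(M, V)`. This exhibits the channel as Gaussian with variance `N + N'` and an
input determined by `(M, V)`. -/
lemma measurePreserving_channel_law [NeZero K] (hQ : 0 < Q) (hN : 0 ≤ N) :
    MeasurePreserving
      (fun ω : Sample K n => ((ω.outcome.M, Code.V ω),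
        fun i => ω.outcome.S i - lam Q σu * Code.V ω i + ω.outcome.Z i))
      (law K n Q σu N)
      (((uniformOn (Set.univ : Set (Fin K))).prod (iidGaussian n (Q + σu ^ 2))).prod
        (iidGaussian n (N + Np Q σu))) := by
  have h1 := measurePreserving_iidGaussian_observation n Q (σu ^ 2) hQ (sq_nonneg _)
  have h3 := (measurePreserving_prodAssoc (iidGaussian n Q) (iidGaussian n (σu ^ 2))
    (iidGaussian n N)).symm
  have h5 := h1.prod (MeasurePreserving.id (iidGaussian n N))
  have h6 := measurePreserving_prodAssoc (iidGaussian n (Q + σu ^ 2))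
    (iidGaussian n (Q * σu ^ 2 / (Q + σu ^ 2))) (iidGaussian n N)
  have h7 := (MeasurePreserving.id (iidGaussian n (Q + σu ^ 2))).prod
    (measurePreserving_iidGaussian_add n (Q * σu ^ 2 / (Q + σu ^ 2)) N (by positivity) hN)
  have h8 := (MeasurePreserving.id (uniformOn (Set.univ : Set (Fin K)))).prod
    (h7.comp (h6.comp (h5.comp h3)))
  have h9 := (measurePreserving_prodAssoc (uniformOn (Set.univ : Set (Fin K)))
    (iidGaussian n (Q + σu ^ 2)) (iidGaussian n (Q * σu ^ 2 / (Q + σu ^ 2) + N))).symm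
  rw [add_comm N]
  exact h9.comp h8

end Law

/-- **Change of measure bound.** For a Gaussian channel with input `x θ`, the expected logarithm of
a test function whose expectation under the Gaussian reference channel with mean `b θ` and
variance `τ` is at most `1` is bounded by the relative entropy of the two channels. -/
lemma integral_log_le_of_lintegral_le_one {Ω Θ : Type*} [MeasurableSpace Ω] [MeasurableSpace Θ]
    {P : Measure Ω} [IsProbabilityMeasure P] {μ : Measure Θ} [SFinite μ] {n : ℕ} {v τ : ℝ}
    (hv : 0 < v) (hτ : 0 < τ) {θ : Ω → Θ} {W : Ω → Fin n → ℝ}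
    (h : MeasurePreserving (fun ω => (θ ω, W ω)) P (μ.prod (iidGaussian n v)))
    {x b : Θ → Fin n → ℝ} (hx : Measurable x) (hb : Measurable b)
    {g : Θ → (Fin n → ℝ) → ℝ} (hg : Measurable (Function.uncurry g)) (hg0 : ∀ ϑ y, 0 < g ϑ y)
    (hg1 : ∫⁻ ϑ, ∫⁻ y, ENNReal.ofReal (g ϑ (b ϑ + y)) ∂(iidGaussian n τ) ∂μ ≤ 1)
    (hlog : Integrable (fun ω => Real.log (g (θ ω) (x (θ ω) + W ω))) P)
    (hW : ∀ i, Integrable (fun ω => W ω i ^ 2) P)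
    (hY : ∀ i, Integrable (fun ω => (x (θ ω) i + W ω i - b (θ ω) i) ^ 2) P) :
    ∫ ω, Real.log (g (θ ω) (x (θ ω) + W ω)) ∂P
      ≤ n / 2 * Real.log (τ / v) - (∑ i, ∫ ω, W ω i ^ 2 ∂P) / (2 * v)
        + (∑ i, ∫ ω, (x (θ ω) i + W ω i - b (θ ω) i) ^ 2 ∂P) / (2 * τ) := by
  -- The test function times the likelihood ratio of the reference channel to the true one, so its
  -- true mean is the reference mean of `g`.
  let H : Θ × (Fin n → ℝ) → ℝ := fun p =>
    g p.1 (x p.1 + p.2) * iidDensity τ (x p.1 + p.2 - b p.1) / iidDensity v p.2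
  have hHm : Measurable H := by
    have h1 : Measurable (fun p : Θ × (Fin n → ℝ) => g p.1 (x p.1 + p.2)) :=
      hg.comp (measurable_fst.prodMk ((hx.comp measurable_fst).add measurable_snd))
    have h2 : Measurable (fun p : Θ × (Fin n → ℝ) => iidDensity τ (x p.1 + p.2 - b p.1)) := by
      fun_prop
    have h3 : Measurable (fun p : Θ × (Fin n → ℝ) => iidDensity v p.2) := by fun_prop
    exact (h1.mul h2).div h3
  have hH0 : ∀ p, 0 < H p := fun p =>
    div_pos (mul_pos (hg0 _ _) (iidDensity_pos hτ _)) (iidDensity_pos hv _)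
  have hH1 : ∫⁻ ω, ENNReal.ofReal (H (θ ω, W ω)) ∂P ≤ 1 := by
    rw [h.lintegral_comp (f := fun p => ENNReal.ofReal (H p)) (by fun_prop),
      lintegral_prod _ (by fun_prop)]
    refine le_trans (le_of_eq (lintegral_congr fun ϑ => ?_)) hg1
    rw [lintegral_iidGaussian hv, lintegral_iidGaussian hτ,
      -- Translation by `b - x` recentres the output from `x + w` to `b + w`.
      ← lintegral_add_right_eq_self _ (b ϑ - x ϑ)]
    refine lintegral_congr fun w => ?_
    rw [← ENNReal.ofReal_mul (iidDensity_pos hv _).le, ← ENNReal.ofReal_mul (iidDensity_pos hτ _).le]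
    congr 1
    simp only [H]
    rw [mul_div_cancel₀ _ (iidDensity_pos hv _).ne', mul_comm]
    congr 2 <;> abel_nf
  have hHi : Integrable (fun ω => H (θ ω, W ω)) P := by
    refine ⟨(hHm.comp_aemeasurable h.aemeasurable).aestronglyMeasurable, ?_⟩
    rw [hasFiniteIntegral_iff_ofReal (ae_of_all _ fun ω => (hH0 _).le)]
    exact hH1.trans_lt ENNReal.one_lt_top
  have hH2 : ∫ ω, H (θ ω, W ω) ∂P ≤ 1 := by
    rw [integral_eq_lintegral_of_nonneg_ae (ae_of_all _ fun ω => (hH0 _).le)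
      hHi.aestronglyMeasurable]
    exact ENNReal.toReal_le_of_le_ofReal zero_le_one (by simpa using hH1)
  have hlogH : ∀ ω, Real.log (g (θ ω) (x (θ ω) + W ω))
      = Real.log (H (θ ω, W ω)) + n / 2 * Real.log (τ / v) - (∑ i, W ω i ^ 2) / (2 * v)
        + (∑ i, (x (θ ω) i + W ω i - b (θ ω) i) ^ 2) / (2 * τ) := by
    intro ω
    simp only [H]
    rw [Real.log_div (mul_pos (hg0 _ _) (iidDensity_pos hτ _)).ne' (iidDensity_pos hv _).ne',
      Real.log_mul (hg0 _ _).ne' (iidDensity_pos hτ _).ne', log_iidDensity hτ, log_iidDensity hv,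
      Real.log_mul (by positivity) hτ.ne', Real.log_mul (by positivity) hv.ne',
      Real.log_div hτ.ne' hv.ne']
    simp only [Pi.add_apply, Pi.sub_apply]
    ring
  have hWi : Integrable (fun ω => (∑ i, W ω i ^ 2) / (2 * v)) P :=
    (integrable_finsetSum _ fun i _ => hW i).div_const _
  have hYi : Integrable (fun ω => (∑ i, (x (θ ω) i + W ω i - b (θ ω) i) ^ 2) / (2 * τ)) P :=
    (integrable_finsetSum _ fun i _ => hY i).div_const _
  have h1 : Integrable (fun ω => H (θ ω, W ω) + (n / 2 * Real.log (τ / v) - 1)) P :=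
    hHi.add (integrable_const _)
  have h2 : Integrable (fun ω => H (θ ω, W ω) + (n / 2 * Real.log (τ / v) - 1)
      - (∑ i, W ω i ^ 2) / (2 * v)) P := h1.sub hWi
  have hle : ∫ ω, Real.log (g (θ ω) (x (θ ω) + W ω)) ∂P ≤
      ∫ ω, ((H (θ ω, W ω) + (n / 2 * Real.log (τ / v) - 1) - (∑ i, W ω i ^ 2) / (2 * v))
        + (∑ i, (x (θ ω) i + W ω i - b (θ ω) i) ^ 2) / (2 * τ)) ∂P := by
    refine integral_mono hlog (h2.add hYi) fun ω => ?_
    rw [hlogH]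
    -- Jensen's inequality in elementary form: `log H ≤ H - 1`, and `H` has mean at most 1.
    have := Real.log_le_sub_one_of_pos (hH0 (θ ω, W ω))
    simp only
    linarith
  refine hle.trans ?_
  rw [integral_add h2 hYi, integral_sub h1 hWi, integral_add hHi (integrable_const _),
    integral_div, integral_div, integral_finsetSum _ fun i _ => hW i,
    integral_finsetSum _ fun i _ => hY i, integral_const]
  simp
  linarith

/-! ### The distortion trade-off in a Hilbert space -/

/-- If `t` is orthogonal to `s`, then approximating `s + t` by `h` with a small error forces the
best multiple of `h` to be a good approximation of `s`. -/
lemma exists_smul_approx {E : Type*} [NormedAddCommGroup E] [InnerProductSpace ℝ E] (s t h : E)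
    (hs : s ≠ 0) (hst : inner ℝ s t = 0) :
    ∃ a : ℝ, ‖s - a • h‖ ≤ ‖s‖ ∧
      ‖s - a • h‖ - ‖t‖ / ‖s‖ * √(‖s‖ ^ 2 - ‖s - a • h‖ ^ 2) ≤ ‖s + t - h‖ := by
  -- The multiple is the orthogonal projection of `s` onto the line of `h`.
  obtain ⟨a, ha⟩ : ∃ a : ℝ, inner ℝ (s - a • h) h = 0 := by
    by_cases hh : h = 0
    · exact ⟨0, by simp [hh]⟩
    · refine ⟨inner ℝ s h / inner ℝ h h, ?_⟩
      have : inner ℝ h h ≠ 0 := inner_self_ne_zero.2 hh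
      rw [inner_sub_left, real_inner_smul_left, div_mul_cancel₀ _ this, sub_self]
  refine ⟨a, ?_⟩
  set e := s - a • h with he
  have hes : inner ℝ e s = ‖e‖ ^ 2 := by
    have : s = e + a • h := by rw [he]; abel
    conv_lhs => rw [this]
    rw [inner_add_right, real_inner_smul_right, ha, real_inner_self_eq_norm_sq]
    ring
  have hspos : 0 < ‖s‖ := norm_pos_iff.2 hs
  have hle : ‖e‖ ≤ ‖s‖ := by
    by_contra hlt
    push Not at hlt
    have := real_inner_le_norm e s
    rw [hes] at this
    nlinarith [norm_nonneg e]
  refine ⟨hle, ?_⟩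
  rcases (norm_nonneg e).eq_or_lt with h0 | hepos
  · rw [← h0]
    have : 0 ≤ ‖t‖ / ‖s‖ * √(‖s‖ ^ 2 - 0 ^ 2) := by positivity
    linarith [norm_nonneg (s + t - h)]
  have hsub : 0 ≤ ‖s‖ ^ 2 - ‖e‖ ^ 2 := by nlinarith
  -- As `t ⟂ s`, only the component of `e` orthogonal to `s` can correlate with `t`.
  have h1 : |inner ℝ e t| ≤ ‖t‖ * (‖e‖ * √(‖s‖ ^ 2 - ‖e‖ ^ 2) / ‖s‖) := by
    have h2 : inner ℝ e t = inner ℝ (e - (‖e‖ ^ 2 / ‖s‖ ^ 2) • s) t := by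
      rw [inner_sub_left e, real_inner_smul_left, hst]; ring
    have h3 : ‖e - (‖e‖ ^ 2 / ‖s‖ ^ 2) • s‖ = ‖e‖ * √(‖s‖ ^ 2 - ‖e‖ ^ 2) / ‖s‖ := by
      rw [← sq_eq_sq₀ (norm_nonneg _) (by positivity), div_pow, mul_pow, Real.sq_sqrt hsub,
        norm_sub_sq_real, real_inner_smul_right, hes, norm_smul, Real.norm_of_nonneg (by positivity)]
      field_simp
      ring
    rw [h2, mul_comm, ← h3]
    exact abs_real_inner_le_norm _ _
  -- Pairing with `e` removes `h`; Cauchy–Schwarz and division by `‖e‖` then finish.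
  have h4 : inner ℝ e (s + t - h) = ‖e‖ ^ 2 + inner ℝ e t := by
    rw [inner_sub_right, inner_add_right, hes, ha, sub_zero]
  have h5 := real_inner_le_norm e (s + t - h)
  rw [h4] at h5
  have h6 := (abs_le.1 h1).1
  have h7 : ‖t‖ * (‖e‖ * √(‖s‖ ^ 2 - ‖e‖ ^ 2) / ‖s‖)
      = ‖e‖ * (‖t‖ / ‖s‖ * √(‖s‖ ^ 2 - ‖e‖ ^ 2)) := by ring
  refine le_of_mul_le_mul_left ?_ hepos
  rw [mul_sub]
  nlinarith

/-! ### The distortion function -/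

section DistortionFunction

variable {Q σu : ℝ}

lemma Qp_pos (hQ : 0 < Q) : 0 < Qp Q σu := by unfold Qp; positivity

lemma Np_nonneg (hQ : 0 < Q) : 0 ≤ Np Q σu := by unfold Np; positivity

lemma continuous_f : Continuous (f Q σu) := by unfold f; fun_prop

lemma f_monotoneOn : MonotoneOn (f Q σu) (Set.Icc 0 (Qp Q σu)) := by
  intro x _ y _ hxy
  unfold f
  gcongr

/-- `f` is bounded from below by a family of affine functions. -/
lemma affine_le_sq_max {k q x u : ℝ} (hk : 0 ≤ k) (hu : 0 < u) (hku : k ≤ u)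
    (hx0 : 0 ≤ x) (hxq : x ≤ q) :
    (1 - k / u) * (x - k * u * (q - x)) ≤ (max (√x - k * √(q - x)) 0) ^ 2 := by
  obtain ⟨a, ha⟩ : ∃ a, √x = a := ⟨_, rfl⟩
  obtain ⟨b, hb⟩ : ∃ b, √(q - x) = b := ⟨_, rfl⟩
  have ha0 : 0 ≤ a := ha ▸ Real.sqrt_nonneg _
  have hb0 : 0 ≤ b := hb ▸ Real.sqrt_nonneg _
  have hxa : x = a ^ 2 := by rw [← ha, Real.sq_sqrt hx0]
  have hqb : q - x = b ^ 2 := by rw [← hb, Real.sq_sqrt (by linarith)]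
  rw [ha, hb, hqb, hxa]
  have hku1 : 0 ≤ 1 - k / u := by rw [sub_nonneg, div_le_one hu]; exact hku
  rcases le_total (a - k * b) 0 with h | h
  · rw [max_eq_right h]
    have h1 : a ^ 2 ≤ k * u * b ^ 2 := by
      have : a ^ 2 ≤ (k * b) ^ 2 := by gcongr; linarith
      have : k * k * b ^ 2 ≤ k * u * b ^ 2 := by gcongr
      nlinarith
    have := mul_nonpos_of_nonneg_of_nonpos hku1 (sub_nonpos.2 h1)
    simpa using this
  · rw [max_eq_left h]
    -- The gap is a nonnegative multiple of a square that vanishes at `u = a / b`, so this slope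
    -- makes the affine minorant touch.
    have h1 : (a - k * b) ^ 2 - (1 - k / u) * (a ^ 2 - k * u * b ^ 2) = k / u * (a - u * b) ^ 2 := by
      field_simp
      ring
    have : 0 ≤ k / u * (a - u * b) ^ 2 := by positivity
    linarith

/-- At a point `z < q` where `f` is positive, the affine minorant with `u = √z / √(q - z)` touches
`f` and serves as a supporting line. Where `f` vanishes, nonnegativity suffices. The endpoint `z =
q` is a convex combination only trivially. -/
lemma f_convexOn : ConvexOn ℝ (Set.Icc 0 (Qp Q σu)) (f Q σu) := by
  refine ⟨convex_Icc _ _, ?_⟩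
  intro x hx y hy a b ha hb hab
  have hk : 0 ≤ √(Np Q σu / Qp Q σu) := Real.sqrt_nonneg _
  unfold f
  simp only [smul_eq_mul]
  set k := √(Np Q σu / Qp Q σu)
  set q := Qp Q σu
  obtain ⟨z, hz⟩ : ∃ z, a * x + b * y = z := ⟨_, rfl⟩
  have hq : a * q + b * q = q := by rw [← add_mul, hab, one_mul]
  have hz0 : 0 ≤ z := by have := hx.1; have := hy.1; rw [← hz]; positivity
  have hxq : a * x ≤ a * q := by gcongr; exact hx.2
  have hyq : b * y ≤ b * q := by gcongr; exact hy.2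
  have hzq : z ≤ q := by linarith
  rw [hz]
  rcases le_or_gt (√z - k * √(q - z)) 0 with h | h
  · rw [max_eq_right h]
    simp only [ne_eq, OfNat.ofNat_ne_zero, not_false_eq_true, zero_pow]
    positivity
  rcases hzq.eq_or_lt with heq | hlt
  · have h1 : a * x = a * q := by linarith
    have h2 : b * y = b * q := by linarith
    rcases ha.eq_or_lt with ha0 | ha0
    · have hb1 : b = 1 := by linarith
      rw [← ha0, hb1] at hz ⊢
      rw [← hz]; simp
    rcases hb.eq_or_lt with hb0 | hb0
    · have ha1 : a = 1 := by linarith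
      rw [← hb0, ha1] at hz ⊢
      rw [← hz]; simp
    rw [mul_left_cancel₀ ha0.ne' h1, mul_left_cancel₀ hb0.ne' h2, heq, ← add_mul, hab, one_mul]
  · have hB : 0 < √(q - z) := Real.sqrt_pos.2 (by linarith)
    have hA : 0 < √z := by
      have : 0 ≤ k * √(q - z) := by positivity
      linarith
    have hu : 0 < √z / √(q - z) := by positivity
    have hku : k ≤ √z / √(q - z) := by rw [le_div_iff₀ hB]; linarith
    have hX := affine_le_sq_max hk hu hku hx.1 hx.2
    have hY := affine_le_sq_max hk hu hku hy.1 hy.2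
    have hZ : (√z - k * √(q - z)) ^ 2 = (1 - k / (√z / √(q - z))) *
        (z - k * (√z / √(q - z)) * (q - z)) := by
      have h1 : z = √z ^ 2 := (Real.sq_sqrt hz0).symm
      have h2 : q - z = √(q - z) ^ 2 := (Real.sq_sqrt (by linarith)).symm
      generalize √z = A at *
      generalize √(q - z) = B at *
      rw [h2, h1]
      field_simp
    rw [max_eq_left h.le, hZ]
    set u := √z / √(q - z)
    calc _ = a * ((1 - k / u) * (x - k * u * (q - x))) +
        b * ((1 - k / u) * (y - k * u * (q - y))) := by
          rw [← hz]
          linear_combination (1 - k / u) * k * u * hq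
      _ ≤ _ := by gcongr

end DistortionFunction

/-! ### Square-integrable random vectors as elements of a Hilbert space -/

section SquareIntegrable

variable {Ω : Type*} [MeasurableSpace Ω] {P : Measure Ω} {n : ℕ}

/-- A random vector with square-integrable entries, as an element of a Hilbert space. -/
def l2vec {F : Fin n → Ω → ℝ} (hF : ∀ i, MemLp (F i) 2 P) :
    PiLp 2 (fun _ : Fin n => Lp ℝ 2 P) :=
  WithLp.toLp 2 fun i => (hF i).toLp

lemma inner_l2vec {F G : Fin n → Ω → ℝ} (hF : ∀ i, MemLp (F i) 2 P)
    (hG : ∀ i, MemLp (G i) 2 P) :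
    inner ℝ (l2vec hF) (l2vec hG) = ∑ i, ∫ ω, F i ω * G i ω ∂P := by
  rw [PiLp.inner_apply]
  refine Finset.sum_congr rfl fun i _ => ?_
  rw [L2.inner_def]
  refine integral_congr_ae ?_
  filter_upwards [(hF i).coeFn_toLp, (hG i).coeFn_toLp] with ω h1 h2
  simp only [l2vec]
  rw [h1, h2]
  simp [mul_comm]

lemma norm_l2vec {F : Fin n → Ω → ℝ} (hF : ∀ i, MemLp (F i) 2 P) :
    ‖l2vec hF‖ = √(∑ i, ∫ ω, F i ω ^ 2 ∂P) := by
  rw [← Real.sqrt_sq (norm_nonneg (l2vec hF)), ← real_inner_self_eq_norm_sq, inner_l2vec]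
  simp_rw [pow_two]

/-- If `T` is uncorrelated with `S'`, then estimating `S' + T` with a small mean square error
forces a multiple of the estimate to be a good estimate of `S'`. -/
lemma exists_mul_estimate {S' T H : Fin n → Ω → ℝ} {A B : ℝ} (hn : 0 < n) (hA : 0 < A)
    (hS : ∀ i, MemLp (S' i) 2 P) (hT : ∀ i, MemLp (T i) 2 P) (hH : ∀ i, MemLp (H i) 2 P)
    (hST : ∀ i, ∫ ω, S' i ω * T i ω ∂P = 0)
    (hSA : ∀ i, ∫ ω, S' i ω ^ 2 ∂P = A) (hTB : ∀ i, ∫ ω, T i ω ^ 2 ∂P = B) (hB : 0 ≤ B) :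
    ∃ a D' : ℝ, ∑ i, ∫ ω, (S' i ω - a * H i ω) ^ 2 ∂P = n * D' ∧ 0 ≤ D' ∧ D' ≤ A ∧
      (max (√D' - √(B / A) * √(A - D')) 0) ^ 2
        ≤ (n : ℝ)⁻¹ * ∑ i, ∫ ω, (S' i ω + T i ω - H i ω) ^ 2 ∂P := by
  have hn' : (0 : ℝ) < n := by exact_mod_cast hn
  have hns : ‖l2vec hS‖ = √n * √A := by
    rw [norm_l2vec]; simp [hSA]
  have hnt : ‖l2vec hT‖ = √n * √B := by
    rw [norm_l2vec]; simp [hTB]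
  have hne : l2vec hS ≠ 0 := by
    rw [← norm_pos_iff, hns]; positivity
  obtain ⟨a, h1, h2⟩ := exists_smul_approx (l2vec hS) (l2vec hT) (l2vec hH) hne
    (by rw [inner_l2vec]; simp [hST])
  have he : ∀ i, MemLp (fun ω => S' i ω - a * H i ω) 2 P :=
    fun i => (hS i).sub ((hH i).const_mul a)
  have hd : ∀ i, MemLp (fun ω => S' i ω + T i ω - H i ω) 2 P :=
    fun i => ((hS i).add (hT i)).sub (hH i)
  have he' : l2vec hS - a • l2vec hH = l2vec he := rfl
  have hd' : l2vec hS + l2vec hT - l2vec hH = l2vec hd := rfl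
  obtain ⟨D', hD'⟩ : ∃ D', ∑ i, ∫ ω, (S' i ω - a * H i ω) ^ 2 ∂P = n * D' :=
    ⟨(∑ i, ∫ ω, (S' i ω - a * H i ω) ^ 2 ∂P) / n, by field_simp⟩
  have hD0 : 0 ≤ D' := by
    have : 0 ≤ n * D' := by
      rw [← hD']
      exact Finset.sum_nonneg fun i _ => integral_nonneg fun ω => sq_nonneg _
    exact nonneg_of_mul_nonneg_right this hn'
  have hne' : ‖l2vec he‖ = √n * √D' := by
    rw [norm_l2vec, hD', Real.sqrt_mul hn'.le]
  have hsn : 0 < √(n : ℝ) := Real.sqrt_pos.2 hn'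
  rw [he', hne', hns] at h1
  have hDA : D' ≤ A := (Real.sqrt_le_sqrt_iff hA.le).1 (le_of_mul_le_mul_left h1 hsn)
  refine ⟨a, D', hD', hD0, hDA, ?_⟩
  rw [he', hd', hne', hns, hnt, norm_l2vec, mul_pow, mul_pow, Real.sq_sqrt hn'.le,
    Real.sq_sqrt hA.le, Real.sq_sqrt hD0, ← mul_sub, Real.sqrt_mul hn'.le,
    mul_div_mul_left _ _ hsn.ne', ← Real.sqrt_div hB] at h2
  set E := ∑ i, ∫ ω, (S' i ω + T i ω - H i ω) ^ 2 ∂P with hE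
  have hE0 : 0 ≤ E := Finset.sum_nonneg fun i _ => integral_nonneg fun ω => sq_nonneg _
  -- Every norm carries a factor `√n`; cancelling it gives the per-letter form.
  have h3 : √D' - √(B / A) * √(A - D') ≤ √((n : ℝ)⁻¹ * E) := by
    refine le_of_mul_le_mul_left ?_ hsn
    rw [← Real.sqrt_mul hn'.le, mul_inv_cancel_left₀ hn'.ne']
    linarith
  calc _ ≤ √((n : ℝ)⁻¹ * E) ^ 2 := by
        gcongr
        exact max_le h3 (Real.sqrt_nonneg _)
    _ = _ := Real.sq_sqrt (by positivity)

lemma memLp_two_of_lintegral_sq_ne_top {F : Ω → ℝ} (hF : AEStronglyMeasurable F P)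
    (h : ∫⁻ ω, ENNReal.ofReal (F ω ^ 2) ∂P ≠ ∞) : MemLp F 2 P := by
  rw [memLp_two_iff_integrable_sq hF]
  refine ⟨hF.pow 2, ?_⟩
  rw [hasFiniteIntegral_iff_ofReal (ae_of_all _ fun ω => sq_nonneg _)]
  exact h.lt_top

/-- A finite average of second moments, computed with Bochner integrals. -/
lemma memLp_and_sum_integral_eq {F : Fin n → Ω → ℝ} (hF : ∀ i, AEStronglyMeasurable (F i) P)
    (h : (n : ℝ≥0∞)⁻¹ * ∑ i, ∫⁻ ω, ENNReal.ofReal (F i ω ^ 2) ∂P ≠ ∞) :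
    (∀ i, MemLp (F i) 2 P) ∧
      (n : ℝ≥0∞)⁻¹ * ∑ i, ∫⁻ ω, ENNReal.ofReal (F i ω ^ 2) ∂P
        = ENNReal.ofReal ((n : ℝ)⁻¹ * ∑ i, ∫ ω, F i ω ^ 2 ∂P) := by
  have hL : ∀ i, MemLp (F i) 2 P := by
    intro i
    refine memLp_two_of_lintegral_sq_ne_top (hF i) fun htop => h ?_
    rw [ENNReal.mul_eq_top]
    left
    exact ⟨by simp, ENNReal.sum_eq_top.2 ⟨i, Finset.mem_univ i, htop⟩⟩
  refine ⟨hL, ?_⟩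
  rcases Nat.eq_zero_or_pos n with h0 | h0
  · subst h0; simp
  have hn' : (0 : ℝ) < n := by exact_mod_cast h0
  rw [ENNReal.ofReal_mul (by positivity), ENNReal.ofReal_inv_of_pos hn', ENNReal.ofReal_natCast,
    ENNReal.ofReal_sum_of_nonneg fun i _ => integral_nonneg fun ω => sq_nonneg _]
  congr 1
  refine Finset.sum_congr rfl fun i _ => ?_
  rw [ofReal_integral_eq_lintegral_ofReal (hL i).integrable_sq (ae_of_all _ fun ω => sq_nonneg _)]

end SquareIntegrable

/-! ### Single-code bounds -/

lemma lintegral_uniformOn_univ {K : ℕ} (F : Fin K → ℝ≥0∞) :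
    ∫⁻ m, F m ∂(uniformOn (Set.univ : Set (Fin K))) = (K : ℝ≥0∞)⁻¹ * ∑ m, F m := by
  rw [lintegral_fintype, Finset.mul_sum]
  refine Finset.sum_congr rfl fun m _ => ?_
  rw [uniformOn_univ, Measure.count_singleton, Fintype.card_fin, mul_comm, one_div]

/-- One term is `K / 2` and the others contribute at most `K / 2` together. Hence the message reward
has mean at most 1 when the message is uniform and independent of the output. -/
lemma sum_ofReal_ite_le {K : ℕ} (hK : 0 < K) (k : Fin K) :
    ∑ m : Fin K, ENNReal.ofReal (if k = m then (K : ℝ) / 2 else 1 / 2) ≤ K := by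
  have hK' : (0 : ℝ) < K := by exact_mod_cast hK
  have h1 : ∀ m : Fin K, (if k = m then (K : ℝ) / 2 else 1 / 2)
      ≤ (if k = m then (K : ℝ) / 2 else 0) + 1 / 2 := by
    intro m; split_ifs <;> linarith
  rw [← ENNReal.ofReal_sum_of_nonneg fun m _ => by split_ifs <;> positivity,
    ← ENNReal.ofReal_natCast]
  refine ENNReal.ofReal_le_ofReal ((Finset.sum_le_sum fun m _ => h1 m).trans ?_)
  rw [Finset.sum_add_distrib, Finset.sum_ite_eq]
  simp
  linarith

/-- Averaging over a uniform message under two iterated integrals. -/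
lemma lintegral_uniformOn_prod_le {K : ℕ} [NeZero K] {α β : Type*} [MeasurableSpace α]
    [MeasurableSpace β] {ρ : Measure α} {γ : Measure β} [SFinite ρ] [SFinite γ]
    {F : Fin K → α → β → ℝ≥0∞} (hF : ∀ m, Measurable fun p : α × β => F m p.1 p.2)
    {G : α → β → ℝ≥0∞} (h : ∀ v y, ∑ m, F m v y ≤ K * G v y) :
    ∫⁻ ϑ : Fin K × α, ∫⁻ y, F ϑ.1 ϑ.2 y ∂γ ∂((uniformOn (Set.univ : Set (Fin K))).prod ρ)
      ≤ ∫⁻ v, ∫⁻ y, G v y ∂γ ∂ρ := by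
  have hF1 : ∀ m, Measurable fun v => ∫⁻ y, F m v y ∂γ := fun m => (hF m).lintegral_prod_right'
  have hF2 : Measurable fun ϑ : Fin K × α => ∫⁻ y, F ϑ.1 ϑ.2 y ∂γ :=
    measurable_from_prod_countable_right hF1
  rw [lintegral_prod _ hF2.aemeasurable, lintegral_uniformOn_univ,
    ← lintegral_finsetSum _ fun m _ => hF1 m]
  have hle : ∀ v, ∑ m, ∫⁻ y, F m v y ∂γ ≤ K * ∫⁻ y, G v y ∂γ := by
    intro v
    have hm : ∀ m, Measurable (fun y => F m v y) := fun m => (hF m).comp measurable_prodMk_left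
    rw [← lintegral_finsetSum _ fun m _ => hm m,
      ← lintegral_const_mul' _ _ (ENNReal.natCast_ne_top K)]
    exact lintegral_mono fun y => h v y
  calc _ ≤ (K : ℝ≥0∞)⁻¹ * ∫⁻ v, K * ∫⁻ y, G v y ∂γ ∂ρ := by
        gcongr with v
        exact hle v
    _ = _ := by
        rw [lintegral_const_mul' _ _ (ENNReal.natCast_ne_top K), ← mul_assoc,
          ENNReal.inv_mul_cancel (by simpa using NeZero.ne K) (ENNReal.natCast_ne_top K), one_mul]

namespace Code

variable {K n : ℕ} {Q σu N : ℝ} (c : Code K n)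

/-- The part of the channel noise that is independent of the message and the observation. -/
def noise (Q σu : ℝ) (ω : Sample K n) : Fin n → ℝ :=
  fun i => ω.outcome.S i - lam Q σu * V ω i + ω.outcome.Z i

lemma Y_eq (ω : Sample K n) (i : Fin n) :
    c.Y ω i = c.X ω i + lam Q σu * V ω i + noise Q σu ω i := by
  simp only [Y, noise]; ring

lemma measurable_V : Measurable (V : Sample K n → Fin n → ℝ) := by
  refine measurable_pi_lambda _ fun i => ?_
  have h1 : Measurable (fun ω : Sample K n => ω.2.1 i) := by fun_prop
  have h2 : Measurable (fun ω : Sample K n => ω.2.2.1 i) := by fun_prop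
  exact h1.add h2

lemma measurable_uncurry_enc : Measurable (Function.uncurry c.enc) :=
  measurable_from_prod_countable_right fun m => c.measurable_enc m

lemma measurable_X : Measurable c.X :=
  c.measurable_uncurry_enc.comp (measurable_fst.prodMk measurable_V)

lemma measurable_Y : Measurable c.Y := by
  refine measurable_pi_lambda _ fun i => ?_
  have h1 : Measurable (fun ω : Sample K n => ω.2.1 i) := by fun_prop
  have h2 : Measurable (fun ω : Sample K n => ω.2.2.2 i) := by fun_prop
  exact (((measurable_pi_apply i).comp c.measurable_X).add h1).add h2

lemma measurable_Mhat : Measurable c.Mhat :=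
  (measurable_fst.comp c.measurable_dec).comp c.measurable_Y

lemma measurable_Shat : Measurable c.Shat :=
  (measurable_snd.comp c.measurable_dec).comp c.measurable_Y

instance isProbabilityMeasure_law [NeZero K] : IsProbabilityMeasure (law K n Q σu N) := by
  unfold law; infer_instance

section Moments

variable [NeZero K]

lemma measurePreserving_V (hQ : 0 < Q) :
    MeasurePreserving V (law K n Q σu N) (iidGaussian n (Q + σu ^ 2)) :=
  measurePreserving_fst.comp (measurePreserving_observation_law hQ)

lemma measurePreserving_noise (hQ : 0 < Q) (hN : 0 ≤ N) :
    MeasurePreserving (noise Q σu) (law K n Q σu N) (iidGaussian n (N + Np Q σu)) :=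
  measurePreserving_snd.comp (measurePreserving_channel_law hQ hN)

lemma sum_integral_add_mul_V_sq (hQ : 0 < Q)
    (hX : ∀ i, MemLp (fun ω => c.X ω i) 2 (law K n Q σu N)) (κ : ℝ) :
    ∑ i, ∫ ω, (c.X ω i + κ * V ω i) ^ 2 ∂(law K n Q σu N)
      = ∑ i, ∫ ω, c.X ω i ^ 2 ∂(law K n Q σu N)
        + 2 * κ * ∑ i, ∫ ω, c.X ω i * V ω i ∂(law K n Q σu N) + κ ^ 2 * (n * (Q + σu ^ 2)) := by
  have hV := measurePreserving_V (K := K) (n := n) (σu := σu) (N := N) hQ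
  have h : ∀ i, ∫ ω, (c.X ω i + κ * V ω i) ^ 2 ∂(law K n Q σu N)
      = ∫ ω, c.X ω i ^ 2 ∂(law K n Q σu N)
        + 2 * κ * ∫ ω, c.X ω i * V ω i ∂(law K n Q σu N) + κ ^ 2 * (Q + σu ^ 2) := by
    intro i
    have hVi := memLp_of_iidGaussian hV i
    have h1 := (hX i).integrable_sq
    have h2 : Integrable (fun ω => 2 * κ * (c.X ω i * V ω i)) (law K n Q σu N) :=
      ((hX i).integrable_mul hVi).const_mul _
    have h3 : Integrable (fun ω => κ ^ 2 * V ω i ^ 2) (law K n Q σu N) :=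
      hVi.integrable_sq.const_mul _
    have h12 : Integrable (fun ω => c.X ω i ^ 2 + 2 * κ * (c.X ω i * V ω i))
      (law K n Q σu N) := h1.add h2
    rw [← integral_sq_of_iidGaussian (by positivity) hV i, ← integral_const_mul,
      ← integral_const_mul, ← integral_add h1 h2, ← integral_add h12 h3]
    congr 1
    ext ω
    ring
  simp_rw [h]
  rw [Finset.sum_add_distrib, Finset.sum_add_distrib, ← Finset.mul_sum]
  simp
  ring

/-- `X + κV` is a function of `(M, V)`, so its cross term with the independent centred noise
vanishes. -/
lemma sum_integral_add_mul_V_add_noise_sq (hQ : 0 < Q) (hN : 0 ≤ N)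
    (hX : ∀ i, MemLp (fun ω => c.X ω i) 2 (law K n Q σu N)) (κ : ℝ) :
    ∑ i, ∫ ω, (c.X ω i + κ * V ω i + noise Q σu ω i) ^ 2 ∂(law K n Q σu N)
      = ∑ i, ∫ ω, c.X ω i ^ 2 ∂(law K n Q σu N)
        + 2 * κ * ∑ i, ∫ ω, c.X ω i * V ω i ∂(law K n Q σu N) + κ ^ 2 * (n * (Q + σu ^ 2))
        + n * (N + Np Q σu) := by
  have hV := measurePreserving_V (K := K) (n := n) (σu := σu) (N := N) hQ
  have hW := measurePreserving_noise (K := K) (n := n) (σu := σu) hQ hN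
  have h : ∀ i, ∫ ω, (c.X ω i + κ * V ω i + noise Q σu ω i) ^ 2 ∂(law K n Q σu N)
      = ∫ ω, (c.X ω i + κ * V ω i) ^ 2 ∂(law K n Q σu N) + (N + Np Q σu) := by
    intro i
    have hA : MemLp (fun ω => c.X ω i + κ * V ω i) 2 (law K n Q σu N) :=
      (hX i).add ((memLp_of_iidGaussian hV i).const_mul κ)
    have hWi := memLp_of_iidGaussian hW i
    have h0 : ∫ ω, (c.X ω i + κ * V ω i) * noise Q σu ω i ∂(law K n Q σu N) = 0 := by
      refine integral_mul_of_iidGaussian (measurePreserving_channel_law hQ hN)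
        (F := fun p => c.enc p.1 p.2 i + κ * p.2 i) ?_ i
      have h1 : Measurable (fun p : Fin K × (Fin n → ℝ) => c.enc p.1 p.2 i) :=
        (measurable_pi_apply i).comp c.measurable_uncurry_enc
      exact h1.add (by fun_prop)
    have h2 : Integrable (fun ω => 2 * ((c.X ω i + κ * V ω i) * noise Q σu ω i))
      (law K n Q σu N) := (hA.integrable_mul hWi).const_mul 2
    have h12 : Integrable (fun ω => (c.X ω i + κ * V ω i) ^ 2
      + 2 * ((c.X ω i + κ * V ω i) * noise Q σu ω i)) (law K n Q σu N) := hA.integrable_sq.add h2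
    have h3 := integral_sq_of_iidGaussian (by have := Np_nonneg (σu := σu) hQ; positivity) hW i
    have h4 : ∫ ω, 2 * ((c.X ω i + κ * V ω i) * noise Q σu ω i) ∂(law K n Q σu N) = 0 := by
      rw [integral_const_mul, h0, mul_zero]
    calc _ = ∫ ω, (((c.X ω i + κ * V ω i) ^ 2
          + 2 * ((c.X ω i + κ * V ω i) * noise Q σu ω i)) + noise Q σu ω i ^ 2)
          ∂(law K n Q σu N) := by
          congr 1; ext ω; ring
      _ = _ := by
          rw [integral_add h12 hWi.integrable_sq, integral_add hA.integrable_sq h2, h4, h3, add_zero]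
  simp_rw [h]
  rw [Finset.sum_add_distrib, c.sum_integral_add_mul_V_sq hQ hX]
  simp [mul_add]

end Moments

/-- The test function that rewards a correct message estimate. -/
def messageTest (m : Fin K) (y : Fin n → ℝ) : ℝ :=
  if (c.dec y).1 = m then (K : ℝ) / 2 else 1 / 2

lemma measurable_messageTest (m : Fin K) : Measurable (c.messageTest m) :=
  Measurable.ite ((measurable_fst.comp c.measurable_dec) (measurableSet_singleton m))
    measurable_const measurable_const

lemma messageTest_pos [NeZero K] (m : Fin K) (y : Fin n → ℝ) : 0 < c.messageTest m y := by
  have hK : (0 : ℝ) < K := by exact_mod_cast Nat.pos_of_ne_zero (NeZero.ne K)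
  unfold messageTest
  split_ifs <;> positivity

lemma measurable_messageTest_mul {g : (Fin n → ℝ) → (Fin n → ℝ) → ℝ}
    (hg : Measurable (Function.uncurry g)) :
    Measurable (Function.uncurry
      fun (ϑ : Fin K × (Fin n → ℝ)) (y : Fin n → ℝ) => c.messageTest ϑ.1 y * g ϑ.2 y) := by
  have h0 : Measurable (Function.uncurry c.messageTest) :=
    measurable_from_prod_countable_right c.measurable_messageTest
  have h1 : Measurable (fun p : (Fin K × (Fin n → ℝ)) × (Fin n → ℝ) => (p.1.1, p.2)) := by
    fun_prop
  have h2 : Measurable (fun p : (Fin K × (Fin n → ℝ)) × (Fin n → ℝ) => (p.1.2, p.2)) := by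
    fun_prop
  exact (h0.comp h1).mul (hg.comp h2)

/-- The reference mean `a • v` does not involve the message, so the message can be averaged out
first at fixed `v` and `y`. -/
lemma lintegral_messageTest_mul_le_one [NeZero K] {ρ γ : Measure (Fin n → ℝ)} [SFinite ρ]
    [SFinite γ] (a : ℝ) {g : (Fin n → ℝ) → (Fin n → ℝ) → ℝ}
    (hg : Measurable (Function.uncurry g))
    (hg1 : ∫⁻ v, ∫⁻ y, ENNReal.ofReal (g v (a • v + y)) ∂γ ∂ρ ≤ 1) :
    ∫⁻ ϑ : Fin K × (Fin n → ℝ), ∫⁻ y, ENNReal.ofReal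
        (c.messageTest ϑ.1 (a • ϑ.2 + y) * g ϑ.2 (a • ϑ.2 + y)) ∂γ
      ∂((uniformOn (Set.univ : Set (Fin K))).prod ρ) ≤ 1 := by
  have hK : 0 < K := Nat.pos_of_ne_zero (NeZero.ne K)
  refine (lintegral_uniformOn_prod_le
    (F := fun m v y => ENNReal.ofReal (c.messageTest m (a • v + y) * g v (a • v + y)))
    (G := fun v y => ENNReal.ofReal (g v (a • v + y))) (fun m => ?_) fun v y => ?_).trans hg1
  · have h : Measurable (fun p : (Fin n → ℝ) × (Fin n → ℝ) => (p.1, a • p.1 + p.2)) := by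
      fun_prop
    have h1 : Measurable (fun p : (Fin n → ℝ) × (Fin n → ℝ) => c.messageTest m p.2) :=
      (c.measurable_messageTest m).comp measurable_snd
    exact ((h1.mul hg).comp h).ennreal_ofReal
  · simp_rw [ENNReal.ofReal_mul (c.messageTest_pos _ _).le]
    rw [← Finset.sum_mul]
    gcongr
    exact sum_ofReal_ite_le hK _

/-- In expectation this is `(1 - Pₑ) log K - log 2`, with `Pₑ` the error probability: the content of
Fano's inequality. -/
lemma log_messageTest [NeZero K] (ω : Sample K n) :
    Real.log (c.messageTest ω.outcome.M (c.Y ω))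
      = (Real.log K - Real.log 2) - {ω : Sample K n | c.Mhat ω ≠ ω.outcome.M}.indicator
          (fun _ => Real.log K) ω := by
  have hK : (0 : ℝ) < K := by exact_mod_cast Nat.pos_of_ne_zero (NeZero.ne K)
  by_cases h : c.Mhat ω = ω.outcome.M
  · have h' : (c.dec (c.Y ω)).1 = ω.outcome.M := h
    rw [Set.indicator_of_notMem (by simpa using h), messageTest, if_pos h',
      Real.log_div hK.ne' two_ne_zero, sub_zero]
  · have h' : ¬ (c.dec (c.Y ω)).1 = ω.outcome.M := h
    rw [Set.indicator_of_mem (by simpa using h), messageTest, if_neg h', one_div, Real.log_inv]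
    ring

/-- **Converse inequality** for the message and a further test function of the observation and
the channel output. -/
lemma log_card_add_integral_log_le [NeZero K] (hn : 0 < n) (hQ : 0 < Q) (hN : 0 ≤ N)
    (hν : 0 < N + Np Q σu) (hX : ∀ i, MemLp (fun ω => c.X ω i) 2 (law K n Q σu N))
    {a τ : ℝ} (hτ : 0 < τ) {g : (Fin n → ℝ) → (Fin n → ℝ) → ℝ}
    (hg : Measurable (Function.uncurry g)) (hg0 : ∀ v y, 0 < g v y)
    (hg1 : ∫⁻ v, ∫⁻ y, ENNReal.ofReal (g v (a • v + y)) ∂(iidGaussian n τ)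
      ∂(iidGaussian n (Q + σu ^ 2)) ≤ 1)
    (hlog : Integrable (fun ω => Real.log (g (V ω) (c.Y ω))) (law K n Q σu N))
    (hY : ∑ i, ∫ ω, (c.Y ω i - a * V ω i) ^ 2 ∂(law K n Q σu N) ≤ n * τ) :
    (1 - (c.errorProb Q σu N).toReal) * Real.log K - Real.log 2
        + ∫ ω, Real.log (g (V ω) (c.Y ω)) ∂(law K n Q σu N)
      ≤ n / 2 * Real.log (τ / (N + Np Q σu)) := by
  have hK : 0 < K := Nat.pos_of_ne_zero (NeZero.ne K)
  have hK' : (0 : ℝ) < K := by exact_mod_cast hK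
  have hn' : (0 : ℝ) < n := by exact_mod_cast hn
  have hV := measurePreserving_V (K := K) (n := n) (σu := σu) (N := N) hQ
  have hW := measurePreserving_noise (K := K) (n := n) (σu := σu) hQ hN
  let G : Fin K × (Fin n → ℝ) → (Fin n → ℝ) → ℝ := fun ϑ y => c.messageTest ϑ.1 y * g ϑ.2 y
  have hGm : Measurable (Function.uncurry G) := c.measurable_messageTest_mul hg
  have hGp : ∀ ϑ y, 0 < G ϑ y := fun ϑ y => mul_pos (c.messageTest_pos _ _) (hg0 _ _)
  -- The conditional mean of `Y` given `(M, V)`.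
  let x : Fin K × (Fin n → ℝ) → Fin n → ℝ := fun ϑ => c.enc ϑ.1 ϑ.2 + lam Q σu • ϑ.2
  have hx : Measurable x := c.measurable_uncurry_enc.add (by fun_prop)
  let b : Fin K × (Fin n → ℝ) → Fin n → ℝ := fun ϑ => a • ϑ.2
  have hb : Measurable b := by fun_prop
  have hxY : ∀ ω : Sample K n, x (ω.outcome.M, V ω) + noise Q σu ω = c.Y ω := by
    intro ω
    ext i
    rw [c.Y_eq (Q := Q) (σu := σu)]
    rfl
  have hxYi : ∀ (ω : Sample K n) (i : Fin n),
      x (ω.outcome.M, V ω) i + noise Q σu ω i - b (ω.outcome.M, V ω) i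
        = c.Y ω i - a * V ω i := by
    intro ω i
    rw [← hxY ω]
    rfl
  have hYi : ∀ i, MemLp (fun ω => c.Y ω i - a * V ω i) 2 (law K n Q σu N) := by
    intro i
    have : (fun ω => c.Y ω i - a * V ω i)
        = fun ω => c.X ω i + (lam Q σu - a) * V ω i + noise Q σu ω i := by
      ext ω
      rw [c.Y_eq (Q := Q) (σu := σu)]
      ring
    rw [this]
    exact ((hX i).add ((memLp_of_iidGaussian hV i).const_mul _)).add (memLp_of_iidGaussian hW i)
  have hE : MeasurableSet {ω : Sample K n | c.Mhat ω ≠ ω.outcome.M} :=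
    (measurableSet_eq_fun c.measurable_Mhat measurable_fst).compl
  have hlogG : ∀ ω : Sample K n, Real.log (G (ω.outcome.M, V ω) (c.Y ω))
      = (Real.log K - Real.log 2) - {ω : Sample K n | c.Mhat ω ≠ ω.outcome.M}.indicator
          (fun _ => Real.log K) ω + Real.log (g (V ω) (c.Y ω)) := by
    intro ω
    rw [Real.log_mul (c.messageTest_pos _ _).ne' (hg0 _ _).ne', c.log_messageTest]
  have hind : Integrable ({ω : Sample K n | c.Mhat ω ≠ ω.outcome.M}.indicator
      (fun _ => Real.log K)) (law K n Q σu N) := (integrable_const _).indicator hE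
  have hfirst : Integrable (fun ω : Sample K n => (Real.log K - Real.log 2)
      - {ω : Sample K n | c.Mhat ω ≠ ω.outcome.M}.indicator (fun _ => Real.log K) ω)
      (law K n Q σu N) := (integrable_const _).sub hind
  have key := integral_log_le_of_lintegral_le_one hν hτ
    (measurePreserving_channel_law (K := K) (n := n) (σu := σu) hQ hN) hx hb hGm hGp ?_ ?_ ?_ ?_
  · change ∫ ω, Real.log (G (ω.outcome.M, V ω) (x (ω.outcome.M, V ω) + noise Q σu ω))
      ∂(law K n Q σu N) ≤ n / 2 * Real.log (τ / (N + Np Q σu))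
      - (∑ i, ∫ ω, noise Q σu ω i ^ 2 ∂(law K n Q σu N)) / (2 * (N + Np Q σu))
      + (∑ i, ∫ ω, (x (ω.outcome.M, V ω) i + noise Q σu ω i - b (ω.outcome.M, V ω) i) ^ 2
        ∂(law K n Q σu N)) / (2 * τ) at key
    simp_rw [hxY, hxYi, hlogG] at key
    rw [integral_add hfirst hlog, integral_sub (integrable_const _) hind,
      integral_indicator_const _ hE, integral_const] at key
    -- Because `τ` dominates the power about the reference mean, this term is absorbed by the noise
    -- term, which equals `n / 2`.
    have h2 : (∑ i, ∫ ω, (c.Y ω i - a * V ω i) ^ 2 ∂(law K n Q σu N)) / (2 * τ) ≤ n / 2 := by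
      rw [div_le_iff₀ (by positivity)]
      linarith
    have h3 : (∑ i, ∫ ω, noise Q σu ω i ^ 2 ∂(law K n Q σu N)) / (2 * (N + Np Q σu)) = n / 2 := by
      simp_rw [integral_sq_of_iidGaussian hν.le hW]
      simp
      field_simp
    rw [h3] at key
    simp only [probReal_univ, smul_eq_mul, one_mul] at key
    have h4 : (law K n Q σu N).real {ω : Sample K n | c.Mhat ω ≠ ω.outcome.M}
      = (c.errorProb Q σu N).toReal := rfl
    rw [h4] at key
    linarith
  · exact c.lintegral_messageTest_mul_le_one a hg hg1
  · change Integrable (fun ω : Sample K n =>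
      Real.log (G (ω.outcome.M, V ω) (x (ω.outcome.M, V ω) + noise Q σu ω))) (law K n Q σu N)
    simp_rw [hxY, hlogG]
    exact hfirst.add hlog
  · exact fun i => (memLp_of_iidGaussian hW i).integrable_sq
  · intro i
    change Integrable (fun ω : Sample K n =>
      (x (ω.outcome.M, V ω) i + noise Q σu ω i - b (ω.outcome.M, V ω) i) ^ 2) (law K n Q σu N)
    simp_rw [hxYi]
    exact (hYi i).integrable_sq

end Code

/-! ### Rate and distortion bounds for one code -/

namespace Code

variable {K n : ℕ} {Q σu N : ℝ} (c : Code K n)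

/-- The empirical correlation `(1/n) ∑ E[X_i V_i]` of channel input and observation. -/
def corr (Q σu N : ℝ) : ℝ := (n : ℝ)⁻¹ * ∑ i, ∫ ω, c.X ω i * V ω i ∂(law K n Q σu N)

lemma sum_integral_eq_corr (hn : 0 < n) :
    ∑ i, ∫ ω, c.X ω i * V ω i ∂(law K n Q σu N) = n * c.corr Q σu N := by
  have hn' : (0 : ℝ) < n := by exact_mod_cast hn
  rw [corr, mul_inv_cancel_left₀ hn'.ne']

/-- The power constraint in terms of Bochner integrals. -/
lemma memLp_X_of_power_le {P : ℝ} (hP : 0 ≤ P) (hn : 0 < n)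
    (hpow : c.power Q σu N ≤ ENNReal.ofReal P) :
    (∀ i, MemLp (fun ω => c.X ω i) 2 (law K n Q σu N)) ∧
      ∑ i, ∫ ω, c.X ω i ^ 2 ∂(law K n Q σu N) ≤ n * P := by
  have hn' : (0 : ℝ) < n := by exact_mod_cast hn
  have hm : ∀ i, AEStronglyMeasurable (fun ω => c.X ω i) (law K n Q σu N) := fun i =>
    ((measurable_pi_apply i).comp c.measurable_X).aestronglyMeasurable
  obtain ⟨h1, h2⟩ := memLp_and_sum_integral_eq hm (hpow.trans_lt ENNReal.ofReal_lt_top).ne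
  refine ⟨h1, ?_⟩
  rw [power, h2, ENNReal.ofReal_le_ofReal_iff hP, inv_mul_le_iff₀ hn'] at hpow
  exact hpow

/-- Here `v` and `y` are independent, so `v` can be integrated first: the density of variance `q`
cancels, leaving the total mass of a Gaussian centred at `h y`. -/
lemma lintegral_iidDensity_ratio_le_one {q d τ : ℝ} (hq : 0 < q) (hd : 0 < d)
    {h : (Fin n → ℝ) → Fin n → ℝ} (hh : Measurable h) :
    ∫⁻ v, ∫⁻ y, ENNReal.ofReal (iidDensity d (v - h y) / iidDensity q v) ∂(iidGaussian n τ)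
      ∂(iidGaussian n q) ≤ 1 := by
  have hm : Measurable fun p : (Fin n → ℝ) × (Fin n → ℝ) =>
      ENNReal.ofReal (iidDensity d (p.1 - h p.2) / iidDensity q p.1) := by fun_prop
  rw [lintegral_lintegral_swap hm.aemeasurable]
  have h1 : ∀ y, ∫⁻ v, ENNReal.ofReal (iidDensity d (v - h y) / iidDensity q v)
      ∂(iidGaussian n q) = 1 := by
    intro y
    rw [lintegral_iidGaussian hq]
    have h2 : ∀ v : Fin n → ℝ, ENNReal.ofReal (iidDensity q v) *
        ENNReal.ofReal (iidDensity d (v - h y) / iidDensity q v)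
        = ENNReal.ofReal (iidDensity d (v - h y)) := by
      intro v
      rw [← ENNReal.ofReal_mul (iidDensity_pos hq _).le, mul_div_cancel₀ _ (iidDensity_pos hq _).ne']
    simp_rw [h2]
    rw [lintegral_sub_right_eq_self (fun v => ENNReal.ofReal (iidDensity d v)) (h y)]
    have h3 := lintegral_iidGaussian (n := n) hd (fun _ => 1)
    simpa using h3.symm
  simp_rw [h1]
  simp

variable [NeZero K]

/-- Cauchy–Schwarz for `X` and `V`, read off from the nonnegative residual of the linear regression
of `X` on `V`. -/
lemma corr_sq_le {P : ℝ} (hn : 0 < n) (hQ : 0 < Q)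
    (hX : ∀ i, MemLp (fun ω => c.X ω i) 2 (law K n Q σu N))
    (hXP : ∑ i, ∫ ω, c.X ω i ^ 2 ∂(law K n Q σu N) ≤ n * P) :
    c.corr Q σu N ^ 2 / (Q + σu ^ 2) ≤ P := by
  have hn' : (0 : ℝ) < n := by exact_mod_cast hn
  have hq : 0 < Q + σu ^ 2 := by positivity
  have h := c.sum_integral_add_mul_V_sq hQ hX (-(c.corr Q σu N / (Q + σu ^ 2)))
  have h0 : 0 ≤ ∑ i, ∫ ω, (c.X ω i + -(c.corr Q σu N / (Q + σu ^ 2)) * V ω i) ^ 2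
      ∂(law K n Q σu N) :=
    Finset.sum_nonneg fun i _ => integral_nonneg fun ω => sq_nonneg _
  rw [h, c.sum_integral_eq_corr hn] at h0
  have h1 : 2 * -(c.corr Q σu N / (Q + σu ^ 2)) * (n * c.corr Q σu N)
      + (-(c.corr Q σu N / (Q + σu ^ 2))) ^ 2 * (n * (Q + σu ^ 2))
      = -(n * (c.corr Q σu N ^ 2 / (Q + σu ^ 2))) := by
    field_simp
    ring
  refine le_of_mul_le_mul_left ?_ hn'
  linarith

/-- The bound on the rate. -/
lemma log_card_le {P : ℝ} (hn : 0 < n) (hQ : 0 < Q) (hN : 0 ≤ N) (hν : 0 < N + Np Q σu)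
    (hX : ∀ i, MemLp (fun ω => c.X ω i) 2 (law K n Q σu N))
    (hXP : ∑ i, ∫ ω, c.X ω i ^ 2 ∂(law K n Q σu N) ≤ n * P) :
    (1 - (c.errorProb Q σu N).toReal) * Real.log K - Real.log 2
      ≤ n / 2 * Real.log ((P - c.corr Q σu N ^ 2 / (Q + σu ^ 2) + (N + Np Q σu))
        / (N + Np Q σu)) := by
  have hq : 0 < Q + σu ^ 2 := by positivity
  set r := c.corr Q σu N with hr
  have hτ : 0 < P - r ^ 2 / (Q + σu ^ 2) + (N + Np Q σu) := by
    have := c.corr_sq_le hn hQ hX hXP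
    linarith
  -- This `a` is the regression coefficient of `Y` on `V`; the residual power is at most the chosen
  -- `τ`.
  have key := c.log_card_add_integral_log_le (a := lam Q σu + r / (Q + σu ^ 2))
    (g := fun _ _ => 1) hn hQ hN hν hX hτ measurable_const (fun _ _ => one_pos) (by simp)
    (by simp) ?_
  · simpa using key
  · have h := c.sum_integral_add_mul_V_add_noise_sq hQ hN hX (-(r / (Q + σu ^ 2)))
    have h1 : ∀ (ω : Sample K n) (i : Fin n),
        c.Y ω i - (lam Q σu + r / (Q + σu ^ 2)) * V ω i
          = c.X ω i + -(r / (Q + σu ^ 2)) * V ω i + noise Q σu ω i := by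
      intro ω i
      rw [c.Y_eq (Q := Q) (σu := σu)]
      ring
    simp_rw [h1]
    rw [h, c.sum_integral_eq_corr hn, ← hr]
    have h2 : 2 * -(r / (Q + σu ^ 2)) * (n * r) + (-(r / (Q + σu ^ 2))) ^ 2 * (n * (Q + σu ^ 2))
        = -(n * (r ^ 2 / (Q + σu ^ 2))) := by
      field_simp
      ring
    linarith

/-- The trade-off between the rate and the accuracy of an estimate of the observation. -/
lemma log_card_add_log_div_le {P : ℝ} (hn : 0 < n) (hQ : 0 < Q) (hN : 0 ≤ N)
    (hν : 0 < N + Np Q σu) (hP : 0 ≤ P)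
    (hX : ∀ i, MemLp (fun ω => c.X ω i) 2 (law K n Q σu N))
    (hXP : ∑ i, ∫ ω, c.X ω i ^ 2 ∂(law K n Q σu N) ≤ n * P)
    {h : (Fin n → ℝ) → Fin n → ℝ} (hh : Measurable h)
    (hhL : ∀ i, MemLp (fun ω => h (c.Y ω) i) 2 (law K n Q σu N)) {d : ℝ} (hd : 0 < d)
    (hd' : ∑ i, ∫ ω, (V ω i - h (c.Y ω) i) ^ 2 ∂(law K n Q σu N) ≤ n * d) :
    (1 - (c.errorProb Q σu N).toReal) * Real.log K - Real.log 2
        + n / 2 * Real.log ((Q + σu ^ 2) / d)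
      ≤ n / 2 * Real.log ((P + Q + N + 2 * lam Q σu * |c.corr Q σu N|) / (N + Np Q σu)) := by
  have hn' : (0 : ℝ) < n := by exact_mod_cast hn
  have hq : 0 < Q + σu ^ 2 := by positivity
  have hl : 0 < lam Q σu := by unfold lam; positivity
  have hV := measurePreserving_V (K := K) (n := n) (σu := σu) (N := N) hQ
  have hVL := memLp_of_iidGaussian hV
  have hτ : 0 < P + Q + N + 2 * lam Q σu * |c.corr Q σu N| := by positivity
  have hVh : ∀ i, Integrable (fun ω => (V ω i - h (c.Y ω) i) ^ 2) (law K n Q σu N) :=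
    fun i => ((hVL i).sub (hhL i)).integrable_sq
  have h1 : Integrable (fun ω => (∑ i, (V ω i - h (c.Y ω) i) ^ 2) / (2 * d)) (law K n Q σu N) :=
    (integrable_finsetSum _ fun i _ => hVh i).div_const _
  have h2 : Integrable (fun ω => (∑ i, V ω i ^ 2) / (2 * (Q + σu ^ 2))) (law K n Q σu N) :=
    (integrable_finsetSum _ fun i _ => (hVL i).integrable_sq).div_const _
  have h3 : Integrable (fun ω => n / 2 * Real.log ((Q + σu ^ 2) / d)
      - (∑ i, (V ω i - h (c.Y ω) i) ^ 2) / (2 * d)) (law K n Q σu N) :=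
    (integrable_const _).sub h1
  have hlog : ∀ ω : Sample K n,
      Real.log (iidDensity d (V ω - h (c.Y ω)) / iidDensity (Q + σu ^ 2) (V ω))
      = n / 2 * Real.log ((Q + σu ^ 2) / d) - (∑ i, (V ω i - h (c.Y ω) i) ^ 2) / (2 * d)
        + (∑ i, V ω i ^ 2) / (2 * (Q + σu ^ 2)) := by
    intro ω
    rw [Real.log_div (iidDensity_pos hd _).ne' (iidDensity_pos hq _).ne', log_iidDensity hd,
      log_iidDensity hq, Real.log_div hq.ne' hd.ne', Real.log_mul (by positivity) hd.ne',
      Real.log_mul (by positivity) hq.ne']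
    simp only [Pi.sub_apply]
    ring
  -- The reference output is independent of `V`. The factor `g` compares a Gaussian of variance `d`
  -- around the estimate with the prior of `V`.
  have key := c.log_card_add_integral_log_le (a := 0)
    (g := fun v y => iidDensity d (v - h y) / iidDensity (Q + σu ^ 2) v)
    hn hQ hN hν hX hτ (by unfold Function.uncurry; fun_prop)
    (fun v y => div_pos (iidDensity_pos hd _) (iidDensity_pos hq _))
    (by simpa using lintegral_iidDensity_ratio_le_one hq hd hh)
    (by simp_rw [hlog]; exact h3.add h2) ?_
  · simp_rw [hlog] at key
    rw [integral_add h3 h2, integral_sub (integrable_const _) h1, integral_div, integral_div,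
      integral_finsetSum _ fun i _ => hVh i,
      integral_finsetSum _ fun i _ => (hVL i).integrable_sq, integral_const] at key
    simp_rw [integral_sq_of_iidGaussian hq.le hV] at key
    have h4 : (∑ i, ∫ ω, (V ω i - h (c.Y ω) i) ^ 2 ∂(law K n Q σu N)) / (2 * d) ≤ n / 2 := by
      rw [div_le_iff₀ (by positivity)]
      linarith
    have h5 : (∑ _i : Fin n, (Q + σu ^ 2)) / (2 * (Q + σu ^ 2)) = (n : ℝ) / 2 := by
      rw [Finset.sum_const, Finset.card_univ, Fintype.card_fin, nsmul_eq_mul]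
      field_simp
    rw [h5] at key
    simp only [probReal_univ, smul_eq_mul, one_mul] at key
    linarith
  · have h6 := c.sum_integral_add_mul_V_add_noise_sq hQ hN hX (lam Q σu)
    have h7 : ∀ (ω : Sample K n) (i : Fin n),
        c.Y ω i - 0 * V ω i = c.X ω i + lam Q σu * V ω i + noise Q σu ω i := by
      intro ω i
      rw [c.Y_eq (Q := Q) (σu := σu), zero_mul, sub_zero]
    simp_rw [h7]
    rw [h6, c.sum_integral_eq_corr hn]
    -- The variances of `λV` and of the unobservable part add up to `Q`.
    have h8 : lam Q σu ^ 2 * (n * (Q + σu ^ 2)) + n * (N + Np Q σu) = n * (Q + N) := by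
      unfold lam Np
      field_simp
      ring
    have h9 : 2 * lam Q σu * (n * c.corr Q σu N) ≤ n * (2 * lam Q σu * |c.corr Q σu N|) := by
      have : n * (2 * lam Q σu * c.corr Q σu N) ≤ n * (2 * lam Q σu * |c.corr Q σu N|) := by
        gcongr
        exact le_abs_self _
      linarith
    linarith

/-- The bound on the distortion. -/
lemma f_le_distortion {P : ℝ} (hn : 0 < n) (hQ : 0 < Q) (hN : 0 ≤ N)
    (hν : 0 < N + Np Q σu) (hP : 0 ≤ P)
    (hX : ∀ i, MemLp (fun ω => c.X ω i) 2 (law K n Q σu N))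
    (hXP : ∑ i, ∫ ω, c.X ω i ^ 2 ∂(law K n Q σu N) ≤ n * P)
    (hD : c.distortion Q σu N ≠ ∞) {L : ℝ}
    (hL : n / 2 * L ≤ (1 - (c.errorProb Q σu N).toReal) * Real.log K - Real.log 2) :
    f Q σu (Qp Q σu * (N + Np Q σu) / (P + Q + N + 2 * lam Q σu * |c.corr Q σu N|)
        * Real.exp L)
      ≤ (c.distortion Q σu N).toReal := by
  have hn' : (0 : ℝ) < n := by exact_mod_cast hn
  have hq : 0 < Q + σu ^ 2 := by positivity
  have hl : 0 < lam Q σu := by unfold lam; positivity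
  have hV := measurePreserving_V (K := K) (n := n) (σu := σu) (N := N) hQ
  have hVL := memLp_of_iidGaussian hV
  have hobs := measurePreserving_observation_law (K := K) (n := n) (σu := σu) (N := N) hQ
  have hT : MeasurePreserving (fun ω : Sample K n => fun i => ω.outcome.S i - lam Q σu * V ω i)
    (law K n Q σu N) (iidGaussian n (Np Q σu)) := measurePreserving_snd.comp hobs
  have hTL := memLp_of_iidGaussian hT
  have hSL : ∀ i, MemLp (fun ω : Sample K n => ω.outcome.S i) 2 (law K n Q σu N) := by
    intro i
    refine ((hTL i).add ((hVL i).const_mul (lam Q σu))).ae_eq ?_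
    exact ae_of_all _ fun ω => by simp
  have hShat : ∀ i, AEStronglyMeasurable (fun ω => c.Shat ω i) (law K n Q σu N) := fun i =>
    ((measurable_pi_apply i).comp c.measurable_Shat).aestronglyMeasurable
  obtain ⟨hSS, hDeq⟩ := memLp_and_sum_integral_eq
    (F := fun i (ω : Sample K n) => ω.outcome.S i - c.Shat ω i)
    (fun i => (hSL i).1.sub (hShat i)) hD
  have hHL : ∀ i, MemLp (fun ω => c.Shat ω i) 2 (law K n Q σu N) := by
    intro i
    refine ((hSL i).sub (hSS i)).ae_eq ?_
    exact ae_of_all _ fun ω => by simp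
  have hQp : lam Q σu ^ 2 * (Q + σu ^ 2) = Qp Q σu := by
    unfold lam Qp
    field_simp
  obtain ⟨a, D', hD', hD0, hDQ, hfD⟩ := exists_mul_estimate (A := Qp Q σu) (B := Np Q σu)
    (S' := fun i (ω : Sample K n) => lam Q σu * V ω i)
    (T := fun i (ω : Sample K n) => ω.outcome.S i - lam Q σu * V ω i)
    (H := fun i ω => c.Shat ω i) hn (Qp_pos hQ) (fun i => (hVL i).const_mul _) hTL hHL
    (fun i => integral_mul_of_iidGaussian hobs (F := fun v : Fin n → ℝ => lam Q σu * v i)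
      (by fun_prop) i)
    (fun i => by
      simp_rw [mul_pow]
      rw [integral_const_mul, integral_sq_of_iidGaussian hq.le hV, hQp])
    (fun i => integral_sq_of_iidGaussian (Np_nonneg hQ) hT i) (Np_nonneg hQ)
  have hdist : (c.distortion Q σu N).toReal
      = (n : ℝ)⁻¹ * ∑ i, ∫ ω, (lam Q σu * V ω i + (ω.outcome.S i - lam Q σu * V ω i)
        - c.Shat ω i) ^ 2 ∂(law K n Q σu N) := by
    rw [distortion, hDeq, ENNReal.toReal_ofReal
      (mul_nonneg (by positivity) (Finset.sum_nonneg fun i _ => integral_nonneg fun ω => sq_nonneg _))]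
    simp only [add_sub_cancel]
  rw [hdist]
  refine le_trans ?_ hfD
  change f Q σu _ ≤ f Q σu D'
  set τ := P + Q + N + 2 * lam Q σu * |c.corr Q σu N| with hτdef
  have hτ : 0 < τ := by positivity
  have hQ' : 0 < Qp Q σu := Qp_pos hQ
  suffices hle : Qp Q σu * (N + Np Q σu) / τ * Real.exp L ≤ D' from
    f_monotoneOn ⟨by positivity, hle.trans hDQ⟩ ⟨hD0, hDQ⟩ hle
  -- The estimate of `λV` is rescaled to one of `V`, dividing its error by `λ²`.
  have hVD : ∑ i, ∫ ω, (V ω i - ((a / lam Q σu) • c.Shat ω) i) ^ 2 ∂(law K n Q σu N)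
      = n * (D' / lam Q σu ^ 2) := by
    have h1 : ∀ (ω : Sample K n) (i : Fin n), (V ω i - ((a / lam Q σu) • c.Shat ω) i) ^ 2
        = (lam Q σu * V ω i - a * c.Shat ω i) ^ 2 / lam Q σu ^ 2 := by
      intro ω i
      simp only [Pi.smul_apply, smul_eq_mul]
      field_simp
    simp_rw [h1, integral_div]
    rw [← Finset.sum_div, hD']
    ring
  -- `D'` may be zero, whereas a Gaussian test density needs positive variance.
  refine le_of_forall_pos_le_add fun ε hε => ?_
  have hd : 0 < (D' + ε) / lam Q σu ^ 2 := by positivity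
  have hdec : Measurable (fun y => (c.dec y).2) := measurable_snd.comp c.measurable_dec
  have key := c.log_card_add_log_div_le hn hQ hN hν hP hX hXP
    (h := fun y => (a / lam Q σu) • (c.dec y).2)
    (hdec.const_smul (a / lam Q σu)) (fun i => (hHL i).const_mul _) hd
    (by
      change ∑ i, ∫ ω, (V ω i - ((a / lam Q σu) • c.Shat ω) i) ^ 2 ∂(law K n Q σu N) ≤ _
      rw [hVD]
      gcongr
      linarith)
  rw [← hτdef] at key
  have h2 : L + Real.log ((Q + σu ^ 2) / ((D' + ε) / lam Q σu ^ 2))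
      ≤ Real.log (τ / (N + Np Q σu)) := by
    refine le_of_mul_le_mul_left ?_ (half_pos hn')
    linarith
  have h3 : (Q + σu ^ 2) / ((D' + ε) / lam Q σu ^ 2) = Qp Q σu / (D' + ε) := by
    rw [← hQp]; field_simp
  rw [h3, ← Real.log_exp L, ← Real.log_mul (Real.exp_pos _).ne' (by positivity),
    Real.log_le_log_iff (by positivity) (by positivity), mul_div_assoc',
    div_le_div_iff₀ (by positivity) hν] at h2
  rw [div_mul_eq_mul_div, div_le_iff₀ hτ]
  linarith

end Code

/-! ### Passage to the limit along a sequence of codes -/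

/-- The rate term of a code with `2^⌈nR⌉` messages. -/
lemma rate_le_log_card {n : ℕ} (hn : 0 < n) {R ε : ℝ} (hε : ε ≤ 1) :
    n / 2 * (2 * (1 - ε) * R * Real.log 2 - 2 * Real.log 2 / n)
      ≤ (1 - ε) * Real.log ((2 ^ ⌈(n : ℝ) * R⌉₊ : ℕ) : ℝ) - Real.log 2 := by
  have hn' : (0 : ℝ) < n := by exact_mod_cast hn
  -- This also covers `R < 0`, where the natural ceiling is 0.
  have h1 : n * R ≤ (⌈(n : ℝ) * R⌉₊ : ℝ) := Nat.le_ceil _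
  have h2 : 0 ≤ Real.log 2 := Real.log_nonneg one_le_two
  push_cast
  rw [Real.log_pow]
  have h3 : (1 - ε) * (n * R * Real.log 2) ≤ (1 - ε) * (⌈(n : ℝ) * R⌉₊ * Real.log 2) := by
    have := sub_nonneg.2 hε
    gcongr
  have h4 : n / 2 * (2 * (1 - ε) * R * Real.log 2 - 2 * Real.log 2 / n)
      = (1 - ε) * (n * R * Real.log 2) - Real.log 2 := by
    field_simp
  linarith

/-- **Converse** for the simultaneous transmission of a message and a noisily observed state. -/
lemma Achievable.exists_corr {P Q N σu R D : ℝ} (hP : 0 ≤ P) (hQ : 0 < Q) (hN : 0 ≤ N)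
    (hν : 0 < N + Np Q σu) (hRD : Achievable P Q N σu R D) :
    ∃ r ∈ Set.Icc 0 (√(P * (Q + σu ^ 2))),
      R * Real.log 2 ≤ 1 / 2 * Real.log ((P - r ^ 2 / (Q + σu ^ 2) + (N + Np Q σu))
        / (N + Np Q σu)) ∧
      f Q σu (Qp Q σu * (N + Np Q σu) / (P + Q + N + 2 * lam Q σu * r)
        * Real.exp (2 * R * Real.log 2)) ≤ D := by
  obtain ⟨c, hpow, herr, hdist⟩ := hRD
  have hq : 0 < Q + σu ^ 2 := by positivity
  have hl : 0 < lam Q σu := by unfold lam; positivity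
  -- The shift by one discards block length 0.
  have hX := fun n => (c (n + 1)).memLp_X_of_power_le hP n.succ_pos (hpow (n + 1))
  -- The absolute value is harmless: the rate bound sees only the square, and the distortion bound
  -- is already stated with it.
  let ρ : ℕ → ℝ := fun n => |(c (n + 1)).corr Q σu N|
  have hρ : ∀ n, ρ n ∈ Set.Icc 0 (√(P * (Q + σu ^ 2))) := by
    intro n
    refine ⟨abs_nonneg _, Real.abs_le_sqrt ?_⟩
    have := (c (n + 1)).corr_sq_le n.succ_pos hQ (hX n).1 (hX n).2
    rwa [div_le_iff₀ hq] at this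
  obtain ⟨r, hr, φ, hφ, hlim⟩ := isCompact_Icc.tendsto_subseq hρ
  have hψ : Tendsto (fun k => φ k + 1) atTop atTop :=
    (tendsto_add_atTop_nat 1).comp hφ.tendsto_atTop
  let ε : ℕ → ℝ := fun k => ((c (φ k + 1)).errorProb Q σu N).toReal
  have hε1 : ∀ k, ε k ≤ 1 := fun k =>
    ENNReal.toReal_le_of_le_ofReal zero_le_one (by simpa [Code.errorProb] using prob_le_one)
  have hεlim : Tendsto ε atTop (𝓝 0) := by
    rw [← ENNReal.toReal_zero]
    exact (ENNReal.tendsto_toReal ENNReal.zero_ne_top).comp (herr.comp hψ)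
  -- Twice the rate in nats, less the losses from decoding errors and from the additive `log 2`;
  -- both vanish in the limit.
  let L : ℕ → ℝ := fun k =>
    2 * (1 - ε k) * R * Real.log 2 - 2 * Real.log 2 / ((φ k + 1 : ℕ) : ℝ)
  have hLlim : Tendsto L atTop (𝓝 (2 * R * Real.log 2)) := by
    have h1 : Tendsto (fun k => 2 * Real.log 2 / ((φ k + 1 : ℕ) : ℝ)) atTop (𝓝 0) :=
      (tendsto_const_div_atTop_nhds_zero_nat _).comp hψ
    have h2 := ((((hεlim.const_sub 1).const_mul 2).mul_const R).mul_const (Real.log 2)).sub h1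
    rw [show 2 * R * Real.log 2 = 2 * (1 - 0) * R * Real.log 2 - 0 by ring]
    exact h2
  have hLle : ∀ k, ((φ k + 1 : ℕ) : ℝ) / 2 * L k ≤ (1 - ε k)
      * Real.log ((2 ^ ⌈((φ k + 1 : ℕ) : ℝ) * R⌉₊ : ℕ) : ℝ) - Real.log 2 := fun k =>
    rate_le_log_card (φ k).succ_pos (hε1 k)
  have hlim' : Tendsto (fun k => ρ (φ k)) atTop (𝓝 r) := hlim
  have hr2 : r ^ 2 / (Q + σu ^ 2) ≤ P := by
    rw [div_le_iff₀ hq]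
    exact (Real.le_sqrt hr.1 (by positivity)).1 hr.2
  refine ⟨r, hr, ?_, ?_⟩
  · have hle : ∀ k, L k ≤ Real.log ((P - ρ (φ k) ^ 2 / (Q + σu ^ 2) + (N + Np Q σu))
        / (N + Np Q σu)) := by
      intro k
      have hpos : (0 : ℝ) < ((φ k + 1 : ℕ) : ℝ) := by positivity
      have h := (c (φ k + 1)).log_card_le (φ k).succ_pos hQ hN hν (hX (φ k)).1 (hX (φ k)).2
      rw [← sq_abs (Code.corr _ _ _ _)] at h
      exact le_of_mul_le_mul_left ((hLle k).trans h) (half_pos hpos)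
    have hcont : Tendsto (fun k => Real.log ((P - ρ (φ k) ^ 2 / (Q + σu ^ 2) + (N + Np Q σu))
        / (N + Np Q σu))) atTop (𝓝 (Real.log ((P - r ^ 2 / (Q + σu ^ 2) + (N + Np Q σu))
        / (N + Np Q σu)))) := by
      refine Tendsto.log ?_ (div_pos (by linarith) hν).ne'
      exact ((((hlim'.pow 2).div_const _).const_sub P).add_const _).div_const _
    have := le_of_tendsto_of_tendsto' hLlim hcont hle
    linarith
  · have hτ : P + Q + N + 2 * lam Q σu * r ≠ 0 := by
      have := hr.1
      positivity
    have hcont : Tendsto (fun k => f Q σu (Qp Q σu * (N + Np Q σu)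
        / (P + Q + N + 2 * lam Q σu * ρ (φ k)) * Real.exp (L k))) atTop
        (𝓝 (f Q σu (Qp Q σu * (N + Np Q σu) / (P + Q + N + 2 * lam Q σu * r)
          * Real.exp (2 * R * Real.log 2)))) := by
      refine (continuous_f.tendsto _).comp (Tendsto.mul ?_ hLlim.rexp)
      exact tendsto_const_nhds.div ((hlim'.const_mul _).const_add _) hτ
    -- The slack turns the `limsup` bound into an eventual strict inequality, which also makes the
    -- distortions finite.
    refine le_of_forall_pos_le_add fun δ hδ => ?_
    refine le_of_tendsto hcont ?_
    have hlt : limsup (fun n => (((c n).distortion Q σu N : ℝ≥0∞) : EReal)) atTop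
        < ((D + δ : ℝ) : EReal) :=
      hdist.trans_lt (EReal.coe_lt_coe_iff.2 (by linarith))
    filter_upwards [hψ.eventually (eventually_lt_of_limsup_lt hlt)] with k hk
    have htop : (c (φ k + 1)).distortion Q σu N ≠ ∞ := by
      intro h
      rw [h] at hk
      exact not_top_lt hk
    refine ((c (φ k + 1)).f_le_distortion (φ k).succ_pos hQ hN hν hP (hX (φ k)).1 (hX (φ k)).2
      htop (hLle k)).trans ?_
    rw [← EReal.coe_ennreal_toReal htop, EReal.coe_lt_coe_iff] at hk
    exact hk.le

end

end StateAmp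

theorem theorem3 (P Q N σu : ℝ) (hP : 0 ≤ P) (hQ : 0 < Q) (hN : 0 ≤ N)
    (hNσ : 0 < N ∨ σu ≠ 0) :
    (ConvexOn ℝ (Set.Icc 0 (StateAmp.Qp Q σu)) (StateAmp.f Q σu) ∧
      MonotoneOn (StateAmp.f Q σu) (Set.Icc 0 (StateAmp.Qp Q σu))) ∧
    ∀ R D : ℝ, StateAmp.Achievable P Q N σu R D →
      ∃ r ∈ Set.Icc 0 (√(P * (Q + σu ^ 2))),
        R ≤ 1 / 2 * Real.logb 2
          ((σu ^ 2 * (N + P + Q) + Q * (N + P) - r ^ 2) /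
            ((Q + σu ^ 2) * (N + StateAmp.Np Q σu))) ∧
        StateAmp.f Q σu
          (StateAmp.Qp Q σu * (N + StateAmp.Np Q σu) /
            (P + Q + N + 2 * StateAmp.lam Q σu * r) * (2 : ℝ) ^ (2 * R)) ≤ D := by
  refine ⟨⟨StateAmp.f_convexOn, StateAmp.f_monotoneOn⟩, fun R D hRD => ?_⟩
  have hq : 0 < Q + σu ^ 2 := by positivity
  -- Either source of randomness makes the effective noise nondegenerate, so it has a density.
  have hν : 0 < N + StateAmp.Np Q σu := by
    rcases hNσ with h | h
    · linarith [StateAmp.Np_nonneg (σu := σu) hQ]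
    · have : 0 < StateAmp.Np Q σu := by unfold StateAmp.Np; positivity
      linarith
  obtain ⟨r, hr, hR, hD⟩ := hRD.exists_corr hP hQ hN hν
  have hlog2 : 0 < Real.log 2 := Real.log_pos one_lt_two
  refine ⟨r, hr, ?_, ?_⟩
  · have h1 : (σu ^ 2 * (N + P + Q) + Q * (N + P) - r ^ 2) /
        ((Q + σu ^ 2) * (N + StateAmp.Np Q σu))
        = (P - r ^ 2 / (Q + σu ^ 2) + (N + StateAmp.Np Q σu)) / (N + StateAmp.Np Q σu) := by
      have h2 : σu ^ 2 * (N + P + Q) + Q * (N + P) - r ^ 2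
          = (Q + σu ^ 2) * (P - r ^ 2 / (Q + σu ^ 2) + (N + StateAmp.Np Q σu)) := by
        unfold StateAmp.Np
        field_simp
        ring
      rw [h2, mul_div_mul_left _ _ hq.ne']
    rw [h1, Real.logb, mul_div_assoc', le_div_iff₀ hlog2]
    exact hR
  · rw [Real.rpow_def_of_pos two_pos, mul_comm (Real.log 2)]
    exact hD
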